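/- Let $r\ge 1$. A charge on a measurable space $(M,\Sigma)$ is a countably additive function $\psi\colon\Sigma\to\mathbb{R}$; it is non-atomic if both measures $\psi^{+},\psi^{-}$ of its Hahn–Jordan decomposition are non-atomic (every measurable set of positive measure has a measurable subset of strictly smaller positive measure). A strong (envy-free) solution for charges $\psi_1,\dots,\psi_r$ is a partition of $M$ into measurable, possibly empty sets $F_1,\dots,F_r$ with $\psi_i(F_i)\ge\psi_i(F_j)$ for all $i,j$. Theorem. (a) For any non-atomic charges $\psi_1,\dots,\psi_r$ on any measurable space $(M,\Sigma)$ there is a strong solution. (b) Moreover, there is an explicit iterative algorithm, depending only on $r$, that finds a strong solution for all non-atomic charges $\psi_1,\dots,\psi_r$ on all measurable spaces $(M,\Sigma)$. Here an algorithm consists of three finite loop-free programs (an initial one, a round, and a final one) and a number of persistent registers. Programs act on registers $R_0,R_1,\dots$ that hold subsets of $M$. At the start $R_0=M$ and all other registers are empty. The instructions are: do nothing; form the union or the difference of two registers; ask participant $i$ for the positive part of a Hahn decomposition of the set in a register with respect to $\psi_i$; ask participant $i$ for a measurable subset $B$ of the set $A$ in a register with $\psi_i(B)=\delta$, where $\delta$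 is a given rational linear combination of the values under $\psi_i$ of the sets in given registers (a valid answer is guaranteed only if $\psi_i$ has constant sign on $A$ and $\delta$ lies between $0$ and $\psi_i(A)$); branch according to whether such a rational linear combination is nonnegative. The initial program is executed once, then the round is executed again and again, the non-persistent registers being emptied after each stage. The final program is applied to the limit of the stages, and participant $i$ receives the content of the $i$-th register ($R_{i-1}$). That the algorithm finds a strong solution means: for all non-atomic charges $\psi_1,\dots,\psi_r$, rules giving valid answers to all these questions exist, and, whatever valid rules are used, the content of each register converges during the rounds (its upper limit $\bigcap_n\bigcup_{k\ge n}A_k$ equals its lower limit $\bigcup_n\bigcap_{k\ge n}A_k$, where $A_k$ is the content after $k$ rounds), and the sets received by the participants are a strong solution. -/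

import Mathlib

open MeasureTheory

namespace FairDivision

/-- A measure is non-atomic if every measurable set of positive measure has a measurable subset
of strictly smaller positive measure (no atoms in the measure-theoretic sense; this is stronger
than all singletons being null). -/
def NonAtomicMeasure {M : Type*} [MeasurableSpace M] (μ : Measure M) : Prop :=
  ∀ A : Set M, MeasurableSet A → 0 < μ A →
    ∃ B : Set M, MeasurableSet B ∧ B ⊆ A ∧ 0 < μ B ∧ μ B < μ A

/-- A (countably additive, real-valued) charge is non-atomic if both measures of its
Hahn-Jordan decomposition are. -/
def NonAtomic {M : Type*} [MeasurableSpace M] (ψ : SignedMeasure M) : Prop :=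
  NonAtomicMeasure ψ.toJordanDecomposition.posPart ∧
    NonAtomicMeasure ψ.toJordanDecomposition.negPart

/-- A measurable partition of `M` into `r` labelled parts; parts may be empty. -/
structure IsMeasurablePartition {M : Type*} [MeasurableSpace M] {r : ℕ}
    (F : Fin r → Set M) : Prop where
  measurableSet : ∀ i, MeasurableSet (F i)
  disjoint : ∀ i j, i ≠ j → Disjoint (F i) (F j)
  iUnion_eq : ⋃ i, F i = Set.univ

/-- A strong (envy-free) solution of the fair division problem. -/
structure IsStrongSolution {M : Type*} [MeasurableSpace M] {r : ℕ}
    (ψ : Fin r → SignedMeasure M) (F : Fin r → Set M) : Prop where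
  partition : IsMeasurablePartition F
  envyFree : ∀ i j, ψ i (F j) ≤ ψ i (F i)

/-- The set-valued questions that an algorithm may put to the participants, and what makes an
answer valid.
* `hahn i A`: the positive part of a Hahn decomposition of `A` for the charge `ψ i`;
* `cut i A δ`: a measurable subset of `A` of value exactly `δ` for participant `i`. A valid answer
  is guaranteed only if `ψ i` has constant sign on `A` and `δ` lies between `0` and `ψ i A`.

Nothing is known about the answer to a question outside these ranges. -/
structure Oracle {M : Type*} [MeasurableSpace M] {r : ℕ} (ψ : Fin r → SignedMeasure M) where
  hahn : Fin r → Set M → Set M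
  cut : Fin r → Set M → ℝ → Set M
  hahn_spec : ∀ (i : Fin r) (A : Set M), MeasurableSet A →
    MeasurableSet (hahn i A) ∧ hahn i A ⊆ A ∧
      0 ≤[hahn i A] ψ i ∧ ψ i ≤[A \ hahn i A] 0
  cut_spec : ∀ (i : Fin r) (A : Set M) (δ : ℝ), MeasurableSet A →
    (0 ≤[A] ψ i ∨ ψ i ≤[A] 0) → δ ∈ Set.uIcc 0 (ψ i A) →
      MeasurableSet (cut i A δ) ∧ cut i A δ ⊆ A ∧ ψ i (cut i A δ) = δ

/-- The memory of an algorithm: registers holding subsets of `M`. -/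
abbrev State (M : Type*) := ℕ → Set M

/-- A linear form with rational coefficients in the values of registers:
`[(q₁, k₁), (q₂, k₂), …]` stands for `q₁ · ψᵢ(register k₁) + q₂ · ψᵢ(register k₂) + ⋯`,
where `i` is the participant who is asked. -/
abbrev LinForm := List (ℚ × ℕ)

/-- The value of a linear form for a charge `φ` in a given state. -/
noncomputable def LinForm.value {M : Type*} [MeasurableSpace M] (c : LinForm)
    (φ : SignedMeasure M) (s : State M) : ℝ :=
  (c.map fun t => (t.1 : ℝ) * φ (s t.2)).sum

/-- Loop-free programs for `r` participants. As finite syntactic objects, they know the charges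
only through the questions they ask. -/
inductive Program (r : ℕ) : Type
  /-- do nothing -/
  | skip : Program r
  /-- `dst := a ∪ b` -/
  | union (dst a b : ℕ) : Program r
  /-- `dst := a \ b` -/
  | diff (dst a b : ℕ) : Program r
  /-- `dst :=` positive part of `a` for participant `i` -/
  | hahn (i : Fin r) (dst a : ℕ) : Program r
  /-- `dst :=` a subset of `a` whose value for participant `i` is the value of `δ` -/
  | cut (i : Fin r) (dst a : ℕ) (δ : LinForm) : Program r
  /-- if the value of `c` for participant `i` is nonnegative then `p` else `q` -/
  | test (i : Fin r) (c : LinForm) (p q : Program r) : Program r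
  /-- first `p`, then `q` -/
  | seq (p q : Program r) : Program r

open Classical in
/-- Execution of a program, questions being answered by the oracle `O`. -/
noncomputable def Program.exec {M : Type*} [MeasurableSpace M] {r : ℕ}
    {ψ : Fin r → SignedMeasure M} (O : Oracle ψ) : Program r → State M → State M
  | .skip, s => s
  | .union dst a b, s => Function.update s dst (s a ∪ s b)
  | .diff dst a b, s => Function.update s dst (s a \ s b)
  | .hahn i dst a, s => Function.update s dst (O.hahn i (s a))
  | .cut i dst a δ, s => Function.update s dst (O.cut i (s a) (δ.value (ψ i) s))
  | .test i c p q, s => if 0 ≤ c.value (ψ i) s then p.exec O s else q.exec O s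
  | .seq p q, s => q.exec O (p.exec O s)

/-- The lower limit of a sequence of sets. -/
def lowerLimit {M : Type*} (A : ℕ → Set M) : Set M := ⋃ n, ⋂ k, ⋂ _ : n ≤ k, A k

/-- The upper limit of a sequence of sets. -/
def upperLimit {M : Type*} (A : ℕ → Set M) : Set M := ⋂ n, ⋃ k, ⋃ _ : n ≤ k, A k

/-- A sequence of sets converges if its upper and lower limits coincide; this common set is
then its limit. -/
def SetConvergent {M : Type*} (A : ℕ → Set M) : Prop := upperLimit A = lowerLimit A

/-- An iterative algorithm for `r` participants: the program `init` is executed once, then the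
program `round` again and again, and the program `final` is applied to the limit. Registers with
number `keep` or larger are scratch memory, cleared after each stage. -/
structure Algorithm (r : ℕ) where
  keep : ℕ
  init : Program r
  round : Program r
  final : Program r

namespace Algorithm

variable {M : Type*} [MeasurableSpace M] {r : ℕ} {ψ : Fin r → SignedMeasure M}

/-- Clearing the scratch registers. -/
def clear (𝒜 : Algorithm r) (s : State M) : State M := fun k => if k < 𝒜.keep then s k else ∅

/-- The initial memory: register `0` holds the whole space, all others are empty. -/
def start : State M := fun k => if k = 0 then Set.univ else ∅

/-- The memory after `init` and `n` rounds. -/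
noncomputable def stage (𝒜 : Algorithm r) (O : Oracle ψ) : ℕ → State M
  | 0 => 𝒜.clear (𝒜.init.exec O start)
  | n + 1 => 𝒜.clear (𝒜.round.exec O (𝒜.stage O n))

/-- The rounds converge: every register does. -/
def Converges (𝒜 : Algorithm r) (O : Oracle ψ) : Prop :=
  ∀ k, SetConvergent fun n => 𝒜.stage O n k

/-- The result: `final` is applied to the limit of the rounds, and participant `i` obtains the
content of register `i`. -/
noncomputable def output (𝒜 : Algorithm r) (O : Oracle ψ) (i : Fin r) : Set M :=
  𝒜.final.exec O (fun k => lowerLimit fun n => 𝒜.stage O n k) i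

end Algorithm

end FairDivision

/-!
The algorithm is an infinite version of the trimming procedure of Brams and Taylor, extended to
chores.

Asking every participant for a Hahn decomposition of the whole space splits it into `2 ^ r`
residues, indexed by the set `T` of those participants for whom they consist of goods. A residue
with `T ≠ ∅` is divided among `T` only, since the others consider it as chores and do not envy;
the residue with `T = ∅` consists of chores for everybody and is divided among all. Partial
divisions without envy can be added up, so it is enough to divide, again and again, parts of the
residues without envy and such that every residue shrinks geometrically for all members of its
group (`exec_divide`). In the limit a residue is worthless for the members of its group, and any one
of them can take it.

In one such step a cutter splits the residue into `N = 3 ^ r` pieces of equal value. Then the other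
members take turns. A participant after whom `k` more are to come ranks the active pieces, and
lowers the best `3 ^ k` of them to the value of the next one, `p`. Goods are lowered by removing a
part. Chores are lowered by adding a part of another piece, which becomes inactive; any piece ranked
below `p` is large enough for this. So each turn makes the active pieces weakly worse for everybody,
and gives the participant `3 ^ k` equally good best pieces. A turn touches at most `2 * 3 ^ k`
pieces; hence the `k` remaining turns touch fewer than `3 ^ k`, by induction. Therefore one of the
`3 ^ k` pieces remains untouched after the turn; it is among the best for the participant, and these
pieces are different for different participants. Similarly, the cutter obtains a completely
untouched piece, that is, the `N`-th part of the residue (`exec_turns`). Letting every member of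
the group be the cutter in each round, the residue shrinks by the factor `1 - 1 / N` for all of them.

A program can make finitely many case distinctions depending on the answers (`Program.select`), so
that neither the rankings nor the final assignment of the pieces have to be computed: the first
possibility that passes the required tests is taken.

That valid rules for answering exist is Sierpiński's theorem on the range of a non-atomic measure
(`NonAtomicMeasure.exists_measureReal_eq`) together with the Hahn decomposition theorem.
-/

namespace FairDivision

/-! ### Non-atomic charges take all intermediate values -/

section Sierpinski

open Filter Topology

variable {M : Type*} [MeasurableSpace M]

theorem NonAtomicMeasure.exists_small {μ : Measure M} [IsFiniteMeasure μ]
    (hμ : NonAtomicMeasure μ) (n : ℕ) {A : Set M} (hA : MeasurableSet A) (h0 : 0 < μ.real A) :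
    ∃ B, MeasurableSet B ∧ B ⊆ A ∧ 0 < μ.real B ∧ μ.real B ≤ μ.real A / 2 ^ n := by
  induction n with
  | zero => exact ⟨A, hA, subset_rfl, h0, by simp⟩
  | succ n ih =>
    obtain ⟨B, hB, hBA, hB0, hBn⟩ := ih
    obtain ⟨C, hC, hCB, hC0, hClt⟩ := hμ B hB (by
      rw [measureReal_def] at hB0
      exact (ENNReal.toReal_pos_iff.1 hB0).1)
    have hC0' : 0 < μ.real C := ENNReal.toReal_pos hC0.ne' (measure_ne_top _ _)
    have hClt' : μ.real C < μ.real B :=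
      (ENNReal.toReal_lt_toReal (measure_ne_top _ _) (measure_ne_top _ _)).2 hClt
    have hsum : μ.real (B \ C) = μ.real B - μ.real C := measureReal_sdiff hCB hC
    have h2 : μ.real A / 2 ^ (n + 1) = μ.real A / 2 ^ n / 2 := by rw [pow_succ]; field_simp
    rcases le_total (μ.real C) (μ.real B / 2) with h | h
    · exact ⟨C, hC, hCB.trans hBA, hC0', by rw [h2]; linarith⟩
    · exact ⟨B \ C, hB.diff hC, Set.sdiff_subset.trans hBA, by linarith, by rw [h2]; linarith⟩

/-- Sierpiński's theorem: a finite non-atomic measure takes all intermediate values. The set is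
built greedily: each step adds a set of at least half the largest measure that still fits. -/
theorem NonAtomicMeasure.exists_measureReal_eq {μ : Measure M} [IsFiniteMeasure μ]
    (hμ : NonAtomicMeasure μ) {A : Set M} (hA : MeasurableSet A) {δ : ℝ} (h0 : 0 ≤ δ)
    (hδ : δ ≤ μ.real A) : ∃ B, MeasurableSet B ∧ B ⊆ A ∧ μ.real B = δ := by
  let V := {E : Set M // MeasurableSet E ∧ E ⊆ A ∧ μ.real E ≤ δ}
  let P : V → Set M → Prop := fun E C => MeasurableSet C ∧ C ⊆ A \ E.1 ∧ μ.real E.1 + μ.real C ≤ δ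
  have key : ∀ E : V, ∃ C, P E C ∧ ∀ C', P E C' → μ.real C' ≤ 2 * μ.real C := by
    intro E
    let S : Set ℝ := {x | ∃ C, P E C ∧ μ.real C = x}
    have hemp : P E ∅ := ⟨MeasurableSet.empty, Set.empty_subset _, by simpa using E.2.2.2⟩
    have hbdd : BddAbove S := by
      refine ⟨δ, ?_⟩
      rintro x ⟨C, hC, rfl⟩
      have := hC.2.2
      have := measureReal_nonneg (μ := μ) (s := E.1)
      linarith
    have hle : ∀ C', P E C' → μ.real C' ≤ sSup S := fun C' h => le_csSup hbdd ⟨C', h, rfl⟩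
    rcases le_or_gt (sSup S) 0 with hs | hs
    · exact ⟨∅, hemp, fun C' h => by simpa using (hle C' h).trans hs⟩
    · obtain ⟨x, ⟨C, hC, rfl⟩, hx⟩ :=
        exists_lt_of_lt_csSup (s := S) ⟨_, ∅, hemp, rfl⟩ (half_lt_self hs)
      exact ⟨C, hC, fun C' h => by linarith [hle C' h]⟩
  choose c hc hmax using key
  let next : V → V := fun E => ⟨E.1 ∪ c E, E.2.1.union (hc E).1,
    Set.union_subset E.2.2.1 ((hc E).2.1.trans Set.sdiff_subset),
    (measureReal_union_le _ _).trans (hc E).2.2⟩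
  let E : ℕ → V := fun n => next^[n] ⟨∅, MeasurableSet.empty, Set.empty_subset _, by simpa using h0⟩
  have hE : ∀ n, (E (n + 1)).1 = (E n).1 ∪ c (E n) := fun n => by
    simp only [E, Function.iterate_succ_apply']; rfl
  have hmono : Monotone fun n => (E n).1 := monotone_nat_of_le_succ fun n => by
    rw [hE]; exact Set.subset_union_left
  have hlim : Tendsto (fun n => μ.real (E n).1) atTop (𝓝 (μ.real (⋃ n, (E n).1))) :=
    (ENNReal.tendsto_toReal (measure_ne_top _ _)).comp (tendsto_measure_iUnion_atTop hmono)
  have hU : MeasurableSet (⋃ n, (E n).1) := MeasurableSet.iUnion fun n => (E n).2.1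
  have hUA : (⋃ n, (E n).1) ⊆ A := Set.iUnion_subset fun n => (E n).2.2.1
  have hUδ : μ.real (⋃ n, (E n).1) ≤ δ := le_of_tendsto' hlim fun n => (E n).2.2.2
  refine ⟨_, hU, hUA, hUδ.antisymm ?_⟩
  by_contra! hlt
  have hd : μ.real (A \ ⋃ n, (E n).1) = μ.real A - μ.real (⋃ n, (E n).1) :=
    measureReal_sdiff hUA hU
  obtain ⟨n, hn⟩ := exists_pow_lt_of_lt_one (y := (1 / 2 : ℝ))
    (div_pos (sub_pos.2 hlt) (by linarith : 0 < μ.real (A \ ⋃ n, (E n).1))) (by norm_num)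
  obtain ⟨C, hC, hCA, hC0, hCn⟩ := hμ.exists_small n (hA.diff hU) (by linarith)
  have hCs : μ.real C ≤ δ - μ.real (⋃ n, (E n).1) := by
    refine hCn.trans ?_
    rw [lt_div_iff₀ (by linarith)] at hn
    rw [div_eq_mul_inv, ← inv_pow, mul_comm]
    rw [one_div] at hn
    exact hn.le
  -- `C` fits at every step, so every step adds at least half of its measure.
  have hstep : ∀ n, μ.real C ≤ 2 * (μ.real (E (n + 1)).1 - μ.real (E n).1) := by
    intro n
    have h1 : μ.real (E n).1 ≤ μ.real (⋃ n, (E n).1) :=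
      measureReal_mono (Set.subset_iUnion (fun n => (E n).1) n)
    have h2 := hmax (E n) C ⟨hC, hCA.trans (Set.sdiff_subset_sdiff_right
      (Set.subset_iUnion (fun n => (E n).1) n)), by linarith⟩
    have h3 : μ.real (E (n + 1)).1 = μ.real (E n).1 + μ.real (c (E n)) := by
      rw [hE]
      exact measureReal_union (Set.disjoint_left.2 fun x hx hx' => ((hc (E n)).2.1 hx').2 hx)
        (hc (E n)).1
    linarith
  have h0lim := ((hlim.comp (tendsto_add_atTop_nat 1)).sub hlim).const_mul 2
  rw [sub_self, mul_zero] at h0lim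
  exact absurd (ge_of_tendsto' h0lim hstep) (not_le.2 hC0)

/-- The negative part vanishes where the charge is nonnegative, so that there the values of the
charge are those of its positive part. -/
theorem negPart_eq_zero_of_zero_le_restrict {φ : SignedMeasure M} {A : Set M}
    (hA : MeasurableSet A) (h : 0 ≤[A] φ) : φ.toJordanDecomposition.negPart A = 0 := by
  obtain ⟨i, hi, h1, h2, -, h3⟩ := φ.toJordanDecomposition_spec
  rw [h3, SignedMeasure.toMeasureOfLEZero_apply _ h2 hi.compl hA]
  have hm : MeasurableSet (iᶜ ∩ A) := hi.compl.inter hA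
  have ha := φ.nonneg_of_zero_le_restrict
    (φ.zero_le_restrict_subset hA Set.inter_subset_right h : 0 ≤[iᶜ ∩ A] φ)
  have hb := φ.nonpos_of_restrict_le_zero
    (φ.restrict_le_zero_subset hi.compl Set.inter_subset_left h2 : φ ≤[iᶜ ∩ A] 0)
  have hz : φ (iᶜ ∩ A) = 0 := le_antisymm hb ha
  simp [hz]

theorem exists_subset_value_eq_of_nonneg {φ : SignedMeasure M}
    (hφ : NonAtomicMeasure φ.toJordanDecomposition.posPart) {A : Set M} (hA : MeasurableSet A)
    (h : 0 ≤[A] φ) {δ : ℝ} (h0 : 0 ≤ δ) (h1 : δ ≤ φ A) :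
    ∃ B, MeasurableSet B ∧ B ⊆ A ∧ φ B = δ := by
  have hneg := negPart_eq_zero_of_zero_le_restrict hA h
  have hval : ∀ B, MeasurableSet B → B ⊆ A →
      φ B = φ.toJordanDecomposition.posPart.real B := fun B hB hBA => by
    rw [φ.apply_eq_posPart_real_sub_negPart_real hB]
    simp [measureReal_def, measure_mono_null hBA hneg]
  obtain ⟨B, hB, hBA, hBδ⟩ := hφ.exists_measureReal_eq hA h0 (by rwa [← hval A hA subset_rfl])
  exact ⟨B, hB, hBA, by rw [hval B hB hBA, hBδ]⟩

theorem NonAtomic.exists_subset_value_eq {φ : SignedMeasure M} (hφ : NonAtomic φ) {A : Set M}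
    (hA : MeasurableSet A) (h : 0 ≤[A] φ ∨ φ ≤[A] 0) {δ : ℝ} (hδ : δ ∈ Set.uIcc 0 (φ A)) :
    ∃ B, MeasurableSet B ∧ B ⊆ A ∧ φ B = δ := by
  rcases h with h | h
  · rw [Set.uIcc_of_le (φ.nonneg_of_zero_le_restrict h)] at hδ
    exact exists_subset_value_eq_of_nonneg hφ.1 hA h hδ.1 hδ.2
  · rw [Set.uIcc_of_ge (φ.nonpos_of_restrict_le_zero h)] at hδ
    obtain ⟨B, hB, hBA, hBδ⟩ := exists_subset_value_eq_of_nonneg (φ := -φ) (δ := -δ)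
      (by rw [SignedMeasure.toJordanDecomposition_neg]; exact hφ.2) hA
      (by simpa using VectorMeasure.neg_le_neg φ 0 hA h) (by linarith [hδ.2])
      (by simpa using hδ.1)
    exact ⟨B, hB, hBA, by simpa using hBδ⟩

/-- Non-atomic participants can answer all questions validly. -/
theorem Oracle.nonempty {r : ℕ} {ψ : Fin r → SignedMeasure M} (hψ : ∀ i, NonAtomic (ψ i)) :
    Nonempty (Oracle ψ) := by
  have hH : ∀ (i : Fin r) (A : Set M), ∃ H, MeasurableSet A →
      MeasurableSet H ∧ H ⊆ A ∧ 0 ≤[H] ψ i ∧ ψ i ≤[A \ H] 0 := by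
    intro i A
    obtain ⟨P, hP, h1, h2⟩ := (ψ i).exists_compl_positive_negative
    refine ⟨A ∩ P, fun hA => ⟨hA.inter hP, Set.inter_subset_left,
      (ψ i).zero_le_restrict_subset hP Set.inter_subset_right h1,
      (ψ i).restrict_le_zero_subset hP.compl (fun x hx => fun hxP => hx.2 ⟨hx.1, hxP⟩) h2⟩⟩
  have hC : ∀ (i : Fin r) (A : Set M) (δ : ℝ), ∃ B, MeasurableSet A →
      (0 ≤[A] ψ i ∨ ψ i ≤[A] 0) → δ ∈ Set.uIcc 0 (ψ i A) →
        MeasurableSet B ∧ B ⊆ A ∧ ψ i B = δ := by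
    intro i A δ
    by_cases h : MeasurableSet A ∧ (0 ≤[A] ψ i ∨ ψ i ≤[A] 0) ∧ δ ∈ Set.uIcc 0 (ψ i A)
    · obtain ⟨B, hB⟩ := (hψ i).exists_subset_value_eq h.1 h.2.1 h.2.2
      exact ⟨B, fun _ _ _ => hB⟩
    · exact ⟨∅, fun h1 h2 h3 => absurd ⟨h1, h2, h3⟩ h⟩
  choose hahn hahn_spec using hH
  choose cut cut_spec using hC
  exact ⟨⟨hahn, cut, hahn_spec, cut_spec⟩⟩

end Sierpinski

/-! ### Composite programs -/

/-- The linear form `ψᵢ(register x) - ψᵢ(register y)`. -/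
def diffForm (x y : ℕ) : LinForm := [(1, x), (-1, y)]

@[simp]
theorem value_diffForm {M : Type*} [MeasurableSpace M] (φ : SignedMeasure M) (s : State M)
    (x y : ℕ) : LinForm.value (diffForm x y) φ s = φ (s x) - φ (s y) := by
  simp [diffForm, LinForm.value, sub_eq_add_neg]

namespace Program

variable {M : Type*} [MeasurableSpace M] {r : ℕ} {ψ : Fin r → SignedMeasure M} (O : Oracle ψ)

/-- Executes the programs of a list one after the other. -/
def block (l : List (Program r)) : Program r := l.foldr seq skip

@[simp]
theorem exec_block_nil (s : State M) : (block []).exec O s = s := rfl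

@[simp]
theorem exec_block_cons (p : Program r) (l : List (Program r)) (s : State M) :
    (block (p :: l)).exec O s = (block l).exec O (p.exec O s) := rfl

/-- Executes `p` if all the tests in `gs` succeed, and `q` otherwise. -/
def guarded (gs : List (Fin r × LinForm)) (p q : Program r) : Program r :=
  gs.foldr (fun g p' => test g.1 g.2 p' q) p

open Classical in
theorem exec_guarded (gs : List (Fin r × LinForm)) (p q : Program r) (s : State M) :
    (guarded gs p q).exec O s =
      if ∀ g ∈ gs, 0 ≤ g.2.value (ψ g.1) s then p.exec O s else q.exec O s := by
  induction gs with
  | nil => simp [guarded]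
  | cons g gs ih =>
    change (test g.1 g.2 (guarded gs p q) q).exec O s = _
    rw [Program.exec, ih]
    by_cases h : 0 ≤ g.2.value (ψ g.1) s <;> simp [h]

/-- Executes the first program in a list of guarded programs all of whose tests succeed. -/
def select (opts : List (List (Fin r × LinForm) × Program r)) : Program r :=
  opts.foldr (fun o q => guarded o.1 o.2 q) skip

theorem exec_select (opts : List (List (Fin r × LinForm) × Program r)) (s : State M)
    (h : ∃ o ∈ opts, ∀ g ∈ o.1, 0 ≤ g.2.value (ψ g.1) s) :
    ∃ o ∈ opts, (∀ g ∈ o.1, 0 ≤ g.2.value (ψ g.1) s) ∧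
      (select opts).exec O s = o.2.exec O s := by
  induction opts with
  | nil => simp at h
  | cons o opts ih =>
    have he : (select (o :: opts)).exec O s = (guarded o.1 o.2 (select opts)).exec O s := rfl
    rw [he, exec_guarded]
    by_cases ho : ∀ g ∈ o.1, 0 ≤ g.2.value (ψ g.1) s
    · exact ⟨o, by simp, ho, if_pos ho⟩
    · obtain ⟨o', ho', hg⟩ := h
      rcases List.mem_cons.1 ho' with rfl | hmem
      · exact absurd hg ho
      · obtain ⟨o₁, h1, h2, h3⟩ := ih ⟨o', hmem, hg⟩
        exact ⟨o₁, List.mem_cons_of_mem _ h1, h2, by rw [if_neg ho, h3]⟩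

/-- Subtracts several registers, none of them `dst`, from the register `dst`. -/
def diffs (dst : ℕ) (l : List ℕ) : Program r := block (l.map fun x => diff dst dst x)

theorem exec_diffs (dst : ℕ) (l : List ℕ) (h : dst ∉ l) (s : State M) :
    (diffs dst l).exec O s = Function.update s dst (s dst \ ⋃ x ∈ l, s x) := by
  induction l generalizing s with
  | nil => simp [diffs]
  | cons x l ih =>
    simp only [List.mem_cons, not_or] at h
    have he : (diffs dst (x :: l)).exec O s
        = (diffs dst l).exec O (Function.update s dst (s dst \ s x)) := rfl
    rw [he, ih h.2]
    simp only [Function.update_self, Function.update_idem]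
    congr 1
    have : ⋃ y ∈ l, Function.update s dst (s dst \ s x) y = ⋃ y ∈ l, s y :=
      Set.iUnion₂_congr fun y hy => Function.update_of_ne (fun e => h.2 (by rwa [← e])) _ _
    rw [this, Set.sdiff_sdiff]
    simp

/-- Moves from register `u` to register `w` a subset whose value for participant `i` is that
of `δ`. -/
def move (i : Fin r) (tmp u w : ℕ) (δ : LinForm) : Program r :=
  block [cut i tmp u δ, diff u u tmp, union w w tmp]

end Program

open Program

/-! ### Levelling pieces down -/

section Levelling

variable {M : Type*} [MeasurableSpace M] {r : ℕ} {ψ : Fin r → SignedMeasure M}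

/-- The registers in `S` hold disjoint measurable subsets of `A`. -/
structure Pieces (s : State M) (A : Set M) (S : Set ℕ) : Prop where
  meas : ∀ x ∈ S, MeasurableSet (s x)
  subset : ∀ x ∈ S, s x ⊆ A
  disj : S.PairwiseDisjoint s

/-- The charge `φ` has constant sign on `A`: `A` consists of goods if `g` is true, and of chores
if `g` is false. -/
def HasSign (g : Bool) (φ : SignedMeasure M) (A : Set M) : Prop :=
  if g then 0 ≤[A] φ else φ ≤[A] 0

theorem HasSign.nonneg {φ : SignedMeasure M} {A B : Set M} (h : HasSign true φ A)
    (hA : MeasurableSet A) (hB : B ⊆ A) : 0 ≤ φ B :=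
  φ.nonneg_of_zero_le_restrict (φ.zero_le_restrict_subset hA hB (by simpa [HasSign] using h))

theorem HasSign.nonpos {φ : SignedMeasure M} {A B : Set M} (h : HasSign false φ A)
    (hA : MeasurableSet A) (hB : B ⊆ A) : φ B ≤ 0 :=
  φ.nonpos_of_restrict_le_zero (φ.restrict_le_zero_subset hA hB (by simpa [HasSign] using h))

theorem HasSign.mono {g : Bool} {φ : SignedMeasure M} {A B : Set M} (h : HasSign g φ A)
    (hA : MeasurableSet A) (hB : B ⊆ A) : HasSign g φ B := by
  cases g
  · simpa [HasSign] using φ.restrict_le_zero_subset hA hB (by simpa [HasSign] using h)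
  · simpa [HasSign] using φ.zero_le_restrict_subset hA hB (by simpa [HasSign] using h)

theorem HasSign.or {g : Bool} {φ : SignedMeasure M} {A : Set M} (h : HasSign g φ A) :
    0 ≤[A] φ ∨ φ ≤[A] 0 := by
  cases g
  · exact Or.inr (by simpa [HasSign] using h)
  · exact Or.inl (by simpa [HasSign] using h)

/-- On a set of constant sign, shrinking a set does not increase the absolute value. -/
theorem HasSign.abs_le_abs {g : Bool} {φ : SignedMeasure M} {A B : Set M} (h : HasSign g φ A)
    (hA : MeasurableSet A) (hB : MeasurableSet B) (hBA : B ⊆ A) : |φ B| ≤ |φ A| := by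
  have hd := φ.of_add_of_sdiff hB hA hBA
  cases g
  · have h1 := h.nonpos hA hBA
    have h2 := h.nonpos hA (Set.sdiff_subset (s := A) (t := B))
    rw [abs_of_nonpos h1, abs_of_nonpos (by linarith)]
    linarith
  · have h1 := h.nonneg hA hBA
    have h2 := h.nonneg hA (Set.sdiff_subset (s := A) (t := B))
    rw [abs_of_nonneg h1, abs_of_nonneg (by linarith)]
    linarith

variable (O : Oracle ψ)

theorem exec_move {s : State M} {A : Set M} {S : Set ℕ} {i : Fin r} {tmp u w : ℕ} {δ : LinForm}
    (hP : Pieces s A S) (hu : u ∈ S) (hw : w ∈ S) (huw : u ≠ w) (ht : tmp ∉ S)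
    (hsign : 0 ≤[s u] ψ i ∨ ψ i ≤[s u] 0) (hδ : δ.value (ψ i) s ∈ Set.uIcc 0 (ψ i (s u)))
    {s' : State M} (hs' : s' = (move i tmp u w δ).exec O s) :
    ∃ X ⊆ s u, MeasurableSet X ∧ ψ i X = δ.value (ψ i) s ∧
      (∀ x, x ≠ u → x ≠ w → x ≠ tmp → s' x = s x) ∧ Pieces s' A S ∧
      (∀ j, ψ j (s' u) = ψ j (s u) - ψ j X) ∧ ∀ j, ψ j (s' w) = ψ j (s w) + ψ j X := by
  obtain ⟨hXm, hXu, hXδ⟩ := O.cut_spec i (s u) _ (hP.meas u hu) hsign hδ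
  set X := O.cut i (s u) (δ.value (ψ i) s) with hX
  have htu : u ≠ tmp := fun e => ht (e ▸ hu)
  have htw : w ≠ tmp := fun e => ht (e ▸ hw)
  have h1 : s' u = s u \ X := by
    simp [hs', move, Program.exec, Function.update_apply, htu, huw, htu.symm, ← hX]
  have h2 : s' w = s w ∪ X := by
    simp [hs', move, Program.exec, Function.update_apply, htw, huw.symm, htu.symm, ← hX]
  have h3 : ∀ x, x ≠ u → x ≠ w → x ≠ tmp → s' x = s x := fun x hx1 hx2 hx3 => by
    simp [hs', move, Program.exec, Function.update_apply, hx1, hx2, hx3]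
  have hdw : Disjoint (s w) X := (hP.disj hw hu huw.symm).mono_right hXu
  refine ⟨X, hXu, hXm, hXδ, h3, ⟨?_, ?_, ?_⟩, ?_, ?_⟩
  · intro x hx
    by_cases hxu : x = u
    · rw [hxu, h1]; exact (hP.meas u hu).diff hXm
    by_cases hxw : x = w
    · rw [hxw, h2]; exact (hP.meas w hw).union hXm
    · rw [h3 x hxu hxw fun e => ht (e ▸ hx)]; exact hP.meas x hx
  · intro x hx
    by_cases hxu : x = u
    · rw [hxu, h1]; exact Set.sdiff_subset.trans (hP.subset u hu)
    by_cases hxw : x = w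
    · rw [hxw, h2]; exact Set.union_subset (hP.subset w hw) (hXu.trans (hP.subset u hu))
    · rw [h3 x hxu hxw fun e => ht (e ▸ hx)]; exact hP.subset x hx
  · have hother : ∀ x ∈ S, x ≠ u → x ≠ w → s' x = s x := fun x hx hxu hxw =>
      h3 x hxu hxw fun e => ht (e ▸ hx)
    have huw' : Disjoint (s' u) (s' w) := by
      rw [h1, h2]
      exact Set.disjoint_union_right.2
        ⟨(hP.disj hu hw huw).mono_left Set.sdiff_subset, Set.disjoint_sdiff_left⟩
    have hux : ∀ x ∈ S, x ≠ u → Disjoint (s' u) (s' x) := fun x hx hxu => by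
      by_cases hxw : x = w
      · rw [hxw]; exact huw'
      · rw [h1, hother x hx hxu hxw]
        exact (hP.disj hu hx (Ne.symm hxu)).mono_left Set.sdiff_subset
    have hwx : ∀ x ∈ S, x ≠ w → Disjoint (s' w) (s' x) := fun x hx hxw => by
      by_cases hxu : x = u
      · rw [hxu]; exact huw'.symm
      · rw [h2, hother x hx hxu hxw]
        exact Set.disjoint_union_left.2
          ⟨hP.disj hw hx (Ne.symm hxw), (hP.disj hu hx (Ne.symm hxu)).mono_left hXu⟩
    intro x hx y hy hxy
    change Disjoint (s' x) (s' y)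
    by_cases hxu : x = u
    · subst hxu; exact hux y hy (Ne.symm hxy)
    by_cases hxw : x = w
    · subst hxw; exact hwx y hy (Ne.symm hxy)
    by_cases hyu : y = u
    · subst hyu; exact (hux x hx hxy).symm
    by_cases hyw : y = w
    · subst hyw; exact (hwx x hx hxy).symm
    rw [hother x hx hxu hxw, hother y hy hyu hyw]
    exact hP.disj hx hy hxy
  · intro j
    rw [h1]
    have := (ψ j).of_add_of_sdiff hXm (hP.meas u hu) hXu
    linarith
  · intro j
    rw [h2, (ψ j).of_union hdw (hP.meas w hw) hXm]

/-- Makes the piece `q` as good as the piece `p` in the opinion of participant `i`, and not better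
than before in anybody's opinion: goods are moved from `q` to `d`, or chores from `d` to `q`. -/
def lower (g : Bool) (i : Fin r) (tmp p q d : ℕ) : Program r :=
  if g then move i tmp q d (diffForm q p) else move i tmp d q (diffForm p q)

/-- The partner `d` suffices as a supply of chores because it is not better than `p`. -/
theorem exec_lower {g : Bool} {s : State M} {A : Set M} {S : Set ℕ} {i : Fin r} {tmp p q d : ℕ}
    {G : Set (Fin r)} (hA : MeasurableSet A) (hG : ∀ j ∈ G, HasSign g (ψ j) A) (hi : i ∈ G)
    (ht : tmp ∉ S) (hP : Pieces s A S) (hp : p ∈ S) (hq : q ∈ S) (hd : d ∈ S) (hqd : q ≠ d)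
    (hpq : ψ i (s p) ≤ ψ i (s q)) (hdp : ψ i (s d) ≤ ψ i (s p))
    {s' : State M} (hs' : s' = (lower g i tmp p q d).exec O s) :
    Pieces s' A S ∧ (∀ x, x ≠ q → x ≠ d → x ≠ tmp → s' x = s x) ∧ ψ i (s' q) = ψ i (s p) ∧
      ∀ j ∈ G, ψ j (s' q) ≤ ψ j (s q) := by
  cases g
  · have hsign := fun x (hx : x ∈ S) => (hG i hi).nonpos hA (hP.subset x hx)
    obtain ⟨X, hXd, hXm, hXδ, h1, h2, h3, h4⟩ := exec_move O (i := i) (δ := diffForm p q)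
      hP hd hq hqd.symm ht ((hG i hi).mono hA (hP.subset d hd)).or (by
        rw [value_diffForm, Set.uIcc_of_ge (hsign d hd)]
        constructor <;> linarith [hsign q hq]) hs'
    rw [value_diffForm] at hXδ
    refine ⟨h2, fun x hx hx' => h1 x hx' hx, by rw [h4, hXδ]; ring, fun j hj => ?_⟩
    rw [h4]
    linarith [(hG j hj).nonpos hA (hXd.trans (hP.subset d hd))]
  · have hsign := fun x (hx : x ∈ S) => (hG i hi).nonneg hA (hP.subset x hx)
    obtain ⟨X, hXq, hXm, hXδ, h1, h2, h3, h4⟩ := exec_move O (i := i) (δ := diffForm q p)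
      hP hq hd hqd ht ((hG i hi).mono hA (hP.subset q hq)).or (by
        rw [value_diffForm, Set.uIcc_of_le (hsign q hq)]
        constructor <;> linarith [hsign p hp]) hs'
    rw [value_diffForm] at hXδ
    refine ⟨h2, h1, by rw [h3, hXδ]; ring, fun j hj => ?_⟩
    rw [h3]
    linarith [(hG j hj).nonneg hA (hXq.trans (hP.subset q hq))]

/-- Lowers every first component of the given pairs to the level of `p`, at the expense or for
the benefit of the second component. -/
def lowerAll (g : Bool) (i : Fin r) (tmp p : ℕ) (l : List (ℕ × ℕ)) : Program r :=
  block (l.map fun x => lower g i tmp p x.1 x.2)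

theorem exec_lowerAll {g : Bool} {A : Set M} {S : Set ℕ} {i : Fin r} {tmp p : ℕ}
    {G : Set (Fin r)} (hA : MeasurableSet A) (hG : ∀ j ∈ G, HasSign g (ψ j) A) (hi : i ∈ G)
    (ht : tmp ∉ S) (hp : p ∈ S) (l : List (ℕ × ℕ)) {s : State M} (hP : Pieces s A S)
    (hl : (p :: (l.map Prod.fst ++ l.map Prod.snd)).Nodup)
    (hlS : ∀ x ∈ l, x.1 ∈ S ∧ x.2 ∈ S)
    (hlp : ∀ x ∈ l, ψ i (s p) ≤ ψ i (s x.1) ∧ ψ i (s x.2) ≤ ψ i (s p))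
    {s' : State M} (hs' : s' = (lowerAll g i tmp p l).exec O s) :
    Pieces s' A S ∧ (∀ x, x ∉ l.map Prod.fst → x ∉ l.map Prod.snd → x ≠ tmp → s' x = s x) ∧
      ∀ q ∈ l.map Prod.fst, ψ i (s' q) = ψ i (s p) ∧ ∀ j ∈ G, ψ j (s' q) ≤ ψ j (s q) := by
  induction l generalizing s with
  | nil => subst hs'; exact ⟨hP, fun _ _ _ _ => rfl, by simp⟩
  | cons x l ih =>
    obtain ⟨q, d⟩ := x
    obtain ⟨hqS, hdS⟩ := hlS (q, d) (by simp)
    obtain ⟨hpq, hdp⟩ := hlp (q, d) (by simp)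
    simp only [List.map_cons, List.cons_append, List.nodup_cons, List.mem_cons, List.mem_append,
      not_or, List.nodup_append, ne_eq] at hl
    obtain ⟨⟨hpq', hp1, hpd', hp2⟩, ⟨hq1, hqd, hq2⟩, hn1, ⟨hd2, hn2⟩, hn12⟩ := hl
    have hd1 : d ∉ l.map Prod.fst := fun h => hn12 d h d (Or.inl rfl) rfl
    obtain ⟨h1, h2, h3, h4⟩ := exec_lower O hA hG hi ht hP hp hqS hdS hqd hpq hdp
      (s' := (lower g i tmp p q d).exec O s) rfl
    set s₁ := (lower g i tmp p q d).exec O s with hs₁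
    have hne : ∀ {y}, y ∈ S → y ≠ tmp := fun h e => ht (e ▸ h)
    have hp₁ : s₁ p = s p := h2 p hpq' hpd' (hne hp)
    have hfst : ∀ y ∈ l.map Prod.fst, y ∈ S ∧ s₁ y = s y := by
      intro y hy
      obtain ⟨z, hz, rfl⟩ := List.mem_map.1 hy
      have hS := (hlS z (List.mem_cons_of_mem _ hz)).1
      exact ⟨hS, h2 _ (fun e : z.1 = q => hq1 (e ▸ hy)) (fun e : z.1 = d => hd1 (e ▸ hy)) (hne hS)⟩
    have hsnd : ∀ y ∈ l.map Prod.snd, s₁ y = s y := by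
      intro y hy
      obtain ⟨z, hz, rfl⟩ := List.mem_map.1 hy
      exact h2 _ (fun e : z.2 = q => hq2 (e ▸ hy)) (fun e : z.2 = d => hd2 (e ▸ hy))
        (hne (hlS z (List.mem_cons_of_mem _ hz)).2)
    obtain ⟨k1, k2, k3⟩ := ih (s := s₁) h1
      (by
        simp only [List.nodup_cons, List.mem_append, not_or, List.nodup_append, ne_eq]
        exact ⟨⟨hp1, hp2⟩, hn1, hn2, fun a ha b hb => hn12 a ha b (Or.inr hb)⟩)
      (fun y hy => hlS y (List.mem_cons_of_mem _ hy))
      (fun y hy => by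
        rw [hp₁, (hfst y.1 (List.mem_map_of_mem hy)).2, hsnd y.2 (List.mem_map_of_mem hy)]
        exact hlp y (List.mem_cons_of_mem _ hy)) hs'
    refine ⟨k1, fun y hy1 hy2 hy => ?_, fun y hy => ?_⟩
    · simp only [List.map_cons, List.mem_cons, not_or] at hy1 hy2
      rw [k2 y hy1.2 hy2.2 hy, h2 y hy1.1 hy2.1 hy]
    · rcases List.mem_cons.1 hy with rfl | hy
      · rw [k2 _ hq1 hq2 (hne hqS)]
        exact ⟨h3, h4⟩
      · rw [← (hfst y hy).2, ← hp₁]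
        exact k3 y hy

end Levelling

/-! ### The turns of the participants -/

section Turns

/-- The first `t` entries of a list, the next one, the `t` entries after it, and the rest. -/
def cutList (t : ℕ) (L : List ℕ) : List ℕ × ℕ × List ℕ × List ℕ :=
  (L.take t, L.getD t 0, (L.drop (t + 1)).take t, (L.drop (t + 1)).drop t)

theorem cutList_spec {t : ℕ} {L : List ℕ} (h : 2 * t + 1 ≤ L.length) {T D Q : List ℕ} {p : ℕ}
    (hc : cutList t L = (T, p, D, Q)) :
    L = T ++ p :: (D ++ Q) ∧ T.length = t ∧ D.length = t := by
  simp only [cutList, Prod.mk.injEq] at hc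
  obtain ⟨rfl, rfl, rfl, rfl⟩ := hc
  have ht : t < L.length := by omega
  refine ⟨?_, by simp; omega, by simp; omega⟩
  rw [List.take_append_drop, List.getD_eq_getElem _ _ ht, ← List.drop_eq_getElem_cons ht,
    List.take_append_drop]

/-- The turns of the participants in the list, applied to the active pieces `act`. With `k`
participants still to come, a participant ranks the active pieces, lowers the best `3 ^ k` of them
to the level of the next one, `p`, using as partners the `3 ^ k` pieces after `p`, which thereby
become inactive. -/
def turns {r : ℕ} (g : Bool) (tmp : ℕ) : List (Fin r) → List ℕ → Program r
  | [], _ => .skip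
  | i :: l, act => select (act.permutations.map fun L =>
      match cutList (3 ^ l.length) L with
      | (T, p, D, Q) =>
        (T.map (fun q => (i, diffForm q p)) ++ (D ++ Q).map (fun d => (i, diffForm p d)),
          .seq (lowerAll g i tmp p (T.zip D)) (turns g tmp l (T ++ p :: Q))))

variable {M : Type*} [MeasurableSpace M] {r : ℕ} {ψ : Fin r → SignedMeasure M} (O : Oracle ψ)

theorem exists_ranking (v : ℕ → ℝ) (act : List ℕ) :
    ∃ L : List ℕ, L.Perm act ∧ L.Pairwise fun x y => v y ≤ v x := by
  classical
  have : Std.Total fun x y => v y ≤ v x := ⟨fun x y => le_total _ _⟩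
  have : IsTrans ℕ fun x y => v y ≤ v x := ⟨fun x y z h1 h2 => h2.trans h1⟩
  exact ⟨act.insertionSort fun x y => v y ≤ v x, List.perm_insertionSort _ _,
    List.pairwise_insertionSort _ _⟩

/-- A turn lowers pieces `T` that its participant ranks above `p`, with partners `D` ranked below `p`,
and is followed by the remaining turns, in which the pieces of `D` are no longer active. -/
theorem exec_turns_cons {g : Bool} {tmp : ℕ} {i : Fin r} {l : List (Fin r)} {act : List ℕ}
    (hlen : 3 ^ (l.length + 1) ≤ act.length) (s : State M) :
    ∃ T p D Q, List.Perm (T ++ p :: (D ++ Q)) act ∧ T.length = 3 ^ l.length ∧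
      D.length = 3 ^ l.length ∧ (∀ q ∈ T, ψ i (s p) ≤ ψ i (s q)) ∧
      (∀ d ∈ D ++ Q, ψ i (s d) ≤ ψ i (s p)) ∧
      (turns g tmp (i :: l) act).exec O s =
        (turns g tmp l (T ++ p :: Q)).exec O ((lowerAll g i tmp p (T.zip D)).exec O s) := by
  have hpos : 0 < 3 ^ l.length := pow_pos (by norm_num) _
  have hlen' : 2 * 3 ^ l.length + 1 ≤ act.length := by rw [pow_succ] at hlen; omega
  obtain ⟨o, ho, hg, he⟩ := exec_select O (act.permutations.map fun L =>
      match cutList (3 ^ l.length) L with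
      | (T, p, D, Q) =>
        (T.map (fun q => (i, diffForm q p)) ++ (D ++ Q).map (fun d => (i, diffForm p d)),
          .seq (lowerAll g i tmp p (T.zip D)) (turns g tmp l (T ++ p :: Q)))) s (by
    obtain ⟨L, hL, hs⟩ := exists_ranking (fun x => ψ i (s x)) act
    refine ⟨_, List.mem_map_of_mem (List.mem_permutations.2 hL), ?_⟩
    rcases hc : cutList (3 ^ l.length) L with ⟨T, p, D, Q⟩
    obtain ⟨rfl, -, -⟩ := cutList_spec (by rwa [hL.length_eq]) hc
    rw [List.pairwise_append, List.pairwise_cons] at hs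
    intro x hx
    rcases List.mem_append.1 hx with hx | hx
    · obtain ⟨q, hq, rfl⟩ := List.mem_map.1 hx
      simpa using hs.2.2 q hq p (by simp)
    · obtain ⟨d, hd, rfl⟩ := List.mem_map.1 hx
      simpa using hs.2.1.1 d hd)
  obtain ⟨L, hL, rfl⟩ := List.mem_map.1 ho
  rw [List.mem_permutations] at hL
  rcases hc : cutList (3 ^ l.length) L with ⟨T, p, D, Q⟩
  obtain ⟨rfl, hT, hD⟩ := cutList_spec (by rwa [hL.length_eq]) hc
  rw [hc] at hg he
  refine ⟨T, p, D, Q, hL, hT, hD, fun q hq => ?_, fun d hd => ?_, he⟩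
  · simpa using hg (i, diffForm q p) (List.mem_append_left _ (List.mem_map_of_mem hq))
  · simpa using hg (i, diffForm p d) (List.mem_append_right _ (List.mem_map_of_mem hd))

/-- After the turns of the participants in `l`, fewer than `3 ^ l.length` pieces, those in `Z`, have
been touched, and the participants in `l` can be given different touched pieces `f i` in such a way
that none of them prefers another piece in `E`, the set of pieces that are still active. -/
theorem exec_turns {g : Bool} {A : Set M} {S : Set ℕ} {tmp : ℕ} {G : Set (Fin r)}
    (hA : MeasurableSet A) (hG : ∀ j ∈ G, HasSign g (ψ j) A) (ht : tmp ∉ S)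
    (l : List (Fin r)) (act : List ℕ) (s : State M) (hl : l.Nodup) (hlG : ∀ i ∈ l, i ∈ G)
    (hact : act.Nodup) (hactS : ∀ x ∈ act, x ∈ S) (hlen : 3 ^ l.length ≤ act.length)
    (hP : Pieces s A S) {s' : State M} (hs' : s' = (turns g tmp l act).exec O s) :
    Pieces s' A S ∧ (∀ x, x ∉ S → x ≠ tmp → s' x = s x) ∧
      ∃ (Z E : Finset ℕ) (f : Fin r → ℕ), Z.card < 3 ^ l.length ∧ E ⊆ act.toFinset ∧
        act.toFinset \ Z ⊆ E ∧ (∀ x ∈ act, x ∉ Z → s' x = s x) ∧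
        (∀ x ∈ E, ∀ j ∈ G, ψ j (s' x) ≤ ψ j (s x)) ∧ (∀ i ∈ l, f i ∈ Z ∧ f i ∈ E) ∧
        (∀ i ∈ l, ∀ j ∈ l, f i = f j → i = j) ∧
        ∀ i ∈ l, ∀ x ∈ E, ψ i (s' x) ≤ ψ i (s' (f i)) := by
  induction l generalizing act s with
  | nil =>
    subst hs'
    exact ⟨hP, fun _ _ _ => rfl, ∅, act.toFinset, fun _ => 0, by simp, subset_rfl,
      Finset.sdiff_subset, fun _ _ _ => rfl, fun _ _ _ _ => le_rfl, by simp, by simp, by simp⟩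
  | cons i l ih =>
    rw [List.length_cons] at hlen ⊢
    have hiG := hlG i (by simp)
    obtain ⟨T, p, D, Q, hperm, hT, hD, hTp, hDp, he⟩ := exec_turns_cons O (ψ := ψ) (g := g)
      (tmp := tmp) (i := i) hlen s
    rw [he] at hs'
    have hmem : ∀ x, x ∈ act ↔ x ∈ T ∨ x = p ∨ x ∈ D ∨ x ∈ Q := fun x => by
      rw [← hperm.mem_iff]; simp
    have hnd := hperm.nodup_iff.2 hact
    simp only [List.nodup_append, List.nodup_cons, List.mem_cons, List.mem_append, ne_eq,
      not_or] at hnd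
    obtain ⟨hnT, ⟨⟨hpD, hpQ⟩, hnD, hnQ, hDQ⟩, hTr⟩ := hnd
    have hTD : ∀ x ∈ T, x ∉ D := fun x hx hx' => hTr x hx x (by simp [hx']) rfl
    have hTQ : ∀ x ∈ T, x ∉ Q := fun x hx hx' => hTr x hx x (by simp [hx']) rfl
    have hTp' : p ∉ T := fun hx => hTr p hx p (by simp) rfl
    have hfst : (T.zip D).map Prod.fst = T := List.map_fst_zip (by omega)
    have hsnd : (T.zip D).map Prod.snd = D := List.map_snd_zip (by omega)
    have hinS : ∀ x, x ∈ T ∨ x = p ∨ x ∈ D ∨ x ∈ Q → x ∈ S := fun x hx =>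
      hactS x ((hmem x).2 hx)
    obtain ⟨h1, h2, h3⟩ := exec_lowerAll O hA hG hiG ht (hinS p (by simp)) (T.zip D) hP
      (s' := (lowerAll g i tmp p (T.zip D)).exec O s)
      (by
        rw [hfst, hsnd]
        simp only [List.nodup_cons, List.mem_append, not_or, List.nodup_append, ne_eq]
        exact ⟨⟨hTp', hpD⟩, hnT, hnD, fun a ha b hb e => hTD a ha (e ▸ hb)⟩)
      (fun x hx => ⟨hinS _ (Or.inl (List.of_mem_zip hx).1),
        hinS _ (Or.inr (Or.inr (Or.inl (List.of_mem_zip hx).2)))⟩)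
      (fun x hx => ⟨hTp _ (List.of_mem_zip hx).1,
        hDp _ (List.mem_append_left _ (List.of_mem_zip hx).2)⟩) rfl
    rw [hfst, hsnd] at h2
    rw [hfst] at h3
    set s₁ := (lowerAll g i tmp p (T.zip D)).exec O s with hs₁
    have hne : ∀ {y}, y ∈ S → y ≠ tmp := fun h e => ht (e ▸ h)
    have hlen₁ : 3 ^ l.length ≤ (T ++ p :: Q).length := by
      rw [List.length_append, hT]; omega
    obtain ⟨k1, k2, Z, E, f, kZ, kE, kE', kfix, kle, kf, kinj, kmax⟩ := ih (T ++ p :: Q) s₁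
      hl.of_cons (fun j hj => hlG j (by simp [hj]))
      (by
        simp only [List.nodup_append, List.nodup_cons, List.mem_cons, ne_eq]
        exact ⟨hnT, ⟨hpQ, hnQ⟩, fun a ha b hb => hTr a ha b (by tauto)⟩)
      (fun x hx => hinS x (by simp at hx; tauto)) hlen₁ h1 hs'
    -- The participant gets a piece of `T` that is not touched afterwards.
    obtain ⟨q, hqT, hqZ⟩ : ∃ q ∈ T, q ∉ Z := by
      by_contra! hcon
      have := Finset.card_le_card (fun x hx => hcon x (List.mem_toFinset.1 hx) : T.toFinset ⊆ Z)
      rw [List.toFinset_card_of_nodup hnT] at this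
      omega
    have hqE : q ∈ E := kE' (by simp [hqT, hqZ])
    have hE₁ : ∀ x ∈ E, x ∈ T ∨ x = p ∨ x ∈ Q := fun x hx => by
      have := kE hx
      simp at this
      tauto
    have hpq : ψ i (s' q) = ψ i (s p) := by
      rw [kfix q (by simp [hqT]) hqZ]; exact (h3 q hqT).1
    have hsame : ∀ x, x = p ∨ x ∈ Q → s₁ x = s x := by
      rintro x (rfl | hx)
      · exact h2 _ hTp' hpD (hne (hinS _ (by simp)))
      · exact h2 _ (fun h => hTQ x h hx) (fun h => hDQ x h x hx rfl) (hne (hinS _ (by simp [hx])))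
    have hib : ∀ x ∈ E, ψ i (s' x) ≤ ψ i (s' q) := fun x hx => by
      refine (kle x hx i hiG).trans ?_
      rw [hpq]
      rcases hE₁ x hx with h | h
      · exact (h3 x h).1.le
      · rw [hsame x h]
        rcases h with rfl | h
        · exact le_rfl
        · exact hDp x (by simp [h])
    have hil : i ∉ l := (List.nodup_cons.1 hl).1
    have hlne : ∀ j ∈ l, j ≠ i := fun j hj e => hil (e ▸ hj)
    refine ⟨k1, fun x hx hx' => ?_, T.toFinset ∪ D.toFinset ∪ Z, E, Function.update f i q,
      ?_, ?_, ?_, ?_, ?_, ?_, ?_, ?_⟩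
    · rw [k2 x hx hx']
      exact h2 x (fun h => hx (hinS x (by simp [h]))) (fun h => hx (hinS x (by simp [h]))) hx'
    · have c1 := Finset.card_union_le (T.toFinset ∪ D.toFinset) Z
      have c2 := Finset.card_union_le T.toFinset D.toFinset
      rw [List.toFinset_card_of_nodup hnT, List.toFinset_card_of_nodup hnD, hT, hD] at c2
      rw [pow_succ]
      omega
    · intro x hx
      rw [List.mem_toFinset, hmem]
      have := hE₁ x hx
      tauto
    · intro x hx
      simp only [Finset.mem_sdiff, List.mem_toFinset, Finset.mem_union, not_or, hmem] at hx
      exact kE' (by simp; tauto)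
    · intro x hx hxZ
      simp only [List.mem_toFinset, Finset.mem_union, not_or, hmem] at hx hxZ
      have hx' : x = p ∨ x ∈ Q := by tauto
      rw [kfix x (by simp [hx']) hxZ.2, hsame x hx']
    · intro x hx j hj
      refine (kle x hx j hj).trans ?_
      rcases hE₁ x hx with h | h
      · exact (h3 x h).2 j hj
      · rw [hsame x h]
    · intro j hj
      rcases List.mem_cons.1 hj with rfl | hj
      · simp [hqT, hqE]
      · simp [Function.update_of_ne (hlne j hj), (kf j hj).1, (kf j hj).2]
    · intro j hj j' hj' hf
      rcases List.mem_cons.1 hj with rfl | hm <;> rcases List.mem_cons.1 hj' with rfl | hm'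
      · rfl
      · rw [Function.update_self, Function.update_of_ne (hlne j' hm')] at hf
        exact absurd (hf ▸ (kf j' hm').1) hqZ
      · rw [Function.update_self, Function.update_of_ne (hlne j hm)] at hf
        exact absurd (hf ▸ (kf j hm).1) hqZ
      · rw [Function.update_of_ne (hlne j hm), Function.update_of_ne (hlne j' hm')] at hf
        exact kinj j hm j' hm' hf
    · intro j hj
      rcases List.mem_cons.1 hj with rfl | hj
      · rw [Function.update_self]; exact hib
      · rw [Function.update_of_ne (hlne j hj)]; exact kmax j hj

end Turns

/-! ### Dividing one residue -/

section Dividing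

variable {M : Type*} [MeasurableSpace M] {r : ℕ} {ψ : Fin r → SignedMeasure M} (O : Oracle ψ)

/-- Participant `c` cuts off from register `tmp`, into each of the registers `xs`, a piece worth
`1 / N` of the register `a`. -/
def cutOff (c : Fin r) (a tmp N : ℕ) (xs : List ℕ) : Program r :=
  block (xs.map fun x => block [.cut c x tmp [(1 / (N : ℚ), a)], .diff tmp tmp x])

theorem exec_cutOff {g : Bool} {c : Fin r} {a tmp N : ℕ} (hN : 0 < N) (hat : a ≠ tmp)
    {xs : List ℕ} (hxs : xs.Nodup) (ha : a ∉ xs) (ht : tmp ∉ xs) {s : State M}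
    (hm : MeasurableSet (s tmp)) (hsign : HasSign g (ψ c) (s tmp))
    (hval : ψ c (s tmp) = xs.length * (ψ c (s a) / N))
    {s' : State M} (hs' : s' = (cutOff c a tmp N xs).exec O s) :
    Pieces s' (s tmp) {x | x ∈ xs} ∧ (∀ x, x ∉ xs → x ≠ tmp → s' x = s x) ∧
      ∀ x ∈ xs, ψ c (s' x) = ψ c (s a) / N := by
  induction xs generalizing s with
  | nil => subst hs'; exact ⟨⟨by simp, by simp, by simp⟩, fun _ _ _ => rfl, by simp⟩
  | cons x xs ih =>
    simp only [List.mem_cons, not_or] at ha ht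
    have hδ : LinForm.value [(1 / (N : ℚ), a)] (ψ c) s = ψ c (s a) / N := by
      simp [LinForm.value]; ring
    have hN' : (0 : ℝ) < N := by exact_mod_cast hN
    obtain ⟨hXm, hXt, hXv⟩ := O.cut_spec c (s tmp) (ψ c (s a) / N) hm hsign.or (by
      have hk : (0 : ℝ) ≤ xs.length := by positivity
      rw [List.length_cons] at hval
      push_cast at hval
      cases g
      · have h0 := hsign.nonpos hm subset_rfl
        have h1 : ψ c (s a) / N ≤ 0 := by
          by_contra! h
          nlinarith
        rw [Set.uIcc_of_ge h0]
        constructor <;> nlinarith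
      · have h0 := hsign.nonneg hm subset_rfl
        have h1 : 0 ≤ ψ c (s a) / N := by
          by_contra! h
          nlinarith
        rw [Set.uIcc_of_le h0]
        constructor <;> nlinarith)
    set X := O.cut c (s tmp) (ψ c (s a) / N) with hX
    set s₁ := (block [.cut c x tmp [(1 / (N : ℚ), a)], .diff tmp tmp x]).exec O s with hs₁
    have e1 : s₁ x = X := by
      simp only [hs₁, exec_block_cons, exec_block_nil, Program.exec, hδ, ← hX]
      simp [Function.update_apply, Ne.symm ht.1]
    have e2 : s₁ tmp = s tmp \ X := by
      simp only [hs₁, exec_block_cons, exec_block_nil, Program.exec, hδ, ← hX]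
      simp [ht.1]
    have e3 : ∀ y, y ≠ x → y ≠ tmp → s₁ y = s y := fun y hy hy' => by
      simp [hs₁, Program.exec, Function.update_apply, hy, hy']
    have ea : s₁ a = s a := e3 a ha.1 hat
    obtain ⟨h1, h2, h3⟩ := ih hxs.of_cons ha.2 ht.2 (s := s₁) (by rw [e2]; exact hm.diff hXm)
      (by rw [e2]; exact hsign.mono hm Set.sdiff_subset)
      (by
        rw [e2, ea]
        have := (ψ c).of_add_of_sdiff hXm hm hXt
        rw [hXv, hval, List.length_cons] at this
        push_cast at this
        linarith) hs'
    have hxx : x ∉ xs := (List.nodup_cons.1 hxs).1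
    have e4 : s' x = X := by rw [h2 x hxx (Ne.symm ht.1), e1]
    rw [e2] at h1
    have hdis : ∀ y ∈ xs, Disjoint (s' x) (s' y) := fun y hy => by
      rw [e4]; exact Set.disjoint_sdiff_right.mono_right (h1.subset y hy)
    refine ⟨⟨?_, ?_, ?_⟩, fun y hy hy' => ?_, ?_⟩
    · intro y hy
      rcases List.mem_cons.1 hy with rfl | hy
      · rw [e4]; exact hXm
      · exact h1.meas y hy
    · intro y hy
      rcases List.mem_cons.1 hy with rfl | hy
      · rw [e4]; exact hXt
      · exact (h1.subset y hy).trans Set.sdiff_subset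
    · intro y hy z hz hyz
      rcases List.mem_cons.1 hy with rfl | hm1 <;> rcases List.mem_cons.1 hz with rfl | hm2
      · exact absurd rfl hyz
      · exact hdis z hm2
      · exact (hdis y hm1).symm
      · exact h1.disj hm1 hm2 hyz
    · simp only [List.mem_cons, not_or] at hy
      rw [h2 y hy.2 hy', e3 y hy.1 hy']
    · intro y hy
      rcases List.mem_cons.1 hy with rfl | hy
      · rw [e4, hXv]
      · rw [h3 y hy, ea]

/-- Adds the register `p i` to the share of each participant `i` in the list. -/
def unions (p : Fin r → ℕ) (L : List (Fin r)) : Program r :=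
  block (L.map fun i : Fin r => .union i i (p i))

theorem exec_unions {p : Fin r → ℕ} {L : List (Fin r)} (hp : ∀ i ∈ L, r ≤ p i) (hL : L.Nodup)
    (s : State M) :
    (∀ i : Fin r, i ∈ L → (unions p L).exec O s i = s i ∪ s (p i)) ∧
      (∀ i : Fin r, i ∉ L → (unions p L).exec O s i = s i) ∧
      ∀ x, r ≤ x → (unions p L).exec O s x = s x := by
  induction L generalizing s with
  | nil => exact ⟨by simp, fun _ _ => rfl, fun _ _ => rfl⟩
  | cons i L ih =>
    have he : (unions p (i :: L)).exec O s
        = (unions p L).exec O (Function.update s i (s i ∪ s (p i))) := rfl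
    rw [he]
    obtain ⟨h1, h2, h3⟩ := ih (fun j hj => hp j (by simp [hj])) hL.of_cons
      (Function.update s i (s i ∪ s (p i)))
    have hiL : i ∉ L := (List.nodup_cons.1 hL).1
    have hreg : ∀ {x}, r ≤ x → x ≠ i := fun hx e => by have := i.2; omega
    refine ⟨fun j hj => ?_, fun j hj => ?_, fun x hx => ?_⟩
    · by_cases hji : j = i
      · subst hji; rw [h2 j hiL]; simp
      · have hjL : j ∈ L := by simpa [hji] using hj
        rw [h1 j hjL, Function.update_of_ne (Fin.val_ne_of_ne hji),
          Function.update_of_ne (hreg (hp j hj))]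
    · simp only [List.mem_cons, not_or] at hj
      rw [h2 j hj.2, Function.update_of_ne (Fin.val_ne_of_ne hj.1)]
    · rw [h3 x hx, Function.update_of_ne (hreg hx)]

/-- The test whether participant `c` receives with register `x` at least the `N`-th part (of the
goods, or of the chores) of register `a`. -/
def progressForm (g : Bool) (a N x : ℕ) : LinForm :=
  if g then [(1, x), (-(1 / N), a)] else [(-1, x), (1 / N, a)]

theorem value_progressForm (g : Bool) (a N x : ℕ) (φ : SignedMeasure M) (s : State M) :
    (progressForm g a N x).value φ s =
      if g then φ (s x) - φ (s a) / N else φ (s a) / N - φ (s x) := by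
  cases g <;> simp [progressForm, LinForm.value] <;> ring

/-- Distributes pieces among the participants in `c :: l`, according to the first assignment of
different pieces that is envy-free and gives the cutter `c` the `N`-th part of the residue `a`. -/
noncomputable def distribute (g : Bool) (a base N : ℕ) (c : Fin r) (l : List (Fin r)) : Program r :=
  select (((Finset.univ.filter fun f : Fin r → Fin N =>
      ∀ i ∈ c :: l, ∀ j ∈ c :: l, f i = f j → i = j).toList).map fun f =>
    ((c, progressForm g a N (base + f c)) :: (c :: l).flatMap (fun i => (c :: l).map fun j =>
        (i, diffForm (base + f i) (base + f j))),
      .seq (unions (fun i => base + f i) (c :: l))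
        (diffs a ((c :: l).map fun i => base + (f i : ℕ)))))

theorem exec_distribute {g : Bool} {a base N : ℕ} {c : Fin r} {l : List (Fin r)} (hra : r ≤ a)
    (hab : a < base) (hl : (c :: l).Nodup) (s : State M)
    (h : ∃ f : Fin r → Fin N, (∀ i ∈ c :: l, ∀ j ∈ c :: l, f i = f j → i = j) ∧
      (∀ i ∈ c :: l, ∀ j ∈ c :: l, ψ i (s (base + f j)) ≤ ψ i (s (base + f i))) ∧
      0 ≤ (progressForm g a N (base + f c)).value (ψ c) s)
    {s' : State M} (hs' : s' = (distribute g a base N c l).exec O s) :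
    ∃ f : Fin r → Fin N, (∀ i ∈ c :: l, ∀ j ∈ c :: l, f i = f j → i = j) ∧
      (∀ i ∈ c :: l, ∀ j ∈ c :: l, ψ i (s (base + f j)) ≤ ψ i (s (base + f i))) ∧
      0 ≤ (progressForm g a N (base + f c)).value (ψ c) s ∧
      (∀ i : Fin r, i ∈ c :: l → s' i = s i ∪ s (base + f i)) ∧ (∀ i : Fin r, i ∉ c :: l → s' i = s i) ∧
      s' a = s a \ ⋃ i ∈ c :: l, s (base + f i) ∧ ∀ x, r ≤ x → x ≠ a → s' x = s x := by
  obtain ⟨o, ho, hg, he⟩ := exec_select O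
    (((Finset.univ.filter fun f : Fin r → Fin N =>
      ∀ i ∈ c :: l, ∀ j ∈ c :: l, f i = f j → i = j).toList).map fun f =>
    ((c, progressForm g a N (base + f c)) :: (c :: l).flatMap (fun i => (c :: l).map fun j =>
        (i, diffForm (base + f i) (base + f j))),
      Program.seq (unions (fun i => base + f i) (c :: l))
        (diffs a ((c :: l).map fun i => base + (f i : ℕ))))) s (by
    obtain ⟨f, hf1, hf2, hf3⟩ := h
    refine ⟨_, List.mem_map_of_mem (Finset.mem_toList.2 (Finset.mem_filter.2
      ⟨Finset.mem_univ f, hf1⟩)), fun x hx => ?_⟩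
    rcases List.mem_cons.1 hx with rfl | hx
    · exact hf3
    · obtain ⟨i, hi, hx⟩ := List.mem_flatMap.1 hx
      obtain ⟨j, hj, rfl⟩ := List.mem_map.1 hx
      simpa using hf2 i hi j hj)
  obtain ⟨f, hf, rfl⟩ := List.mem_map.1 ho
  have hf1 := (Finset.mem_filter.1 (Finset.mem_toList.1 hf)).2
  have hs₂ : s' = (diffs a ((c :: l).map fun i => base + (f i : ℕ))).exec O
      ((unions (fun i => base + f i) (c :: l)).exec O s) := by rw [hs']; exact he
  rw [exec_diffs O a _ (by simp only [List.mem_map, not_exists, not_and]; omega)] at hs₂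
  obtain ⟨k1, k2, k3⟩ := exec_unions O (p := fun i => base + (f i : ℕ)) (L := c :: l)
    (fun i _ => by omega) hl s
  have hia : ∀ i : Fin r, (i : ℕ) ≠ a := fun i e => by have := i.2; omega
  refine ⟨f, hf1, fun i hi j hj => ?_, hg _ List.mem_cons_self, fun i hi => ?_, fun i hi => ?_,
    ?_, fun x hx hxa => ?_⟩
  · simpa using hg (i, diffForm (base + f i) (base + f j)) (List.mem_cons_of_mem _
      (List.mem_flatMap.2 ⟨i, hi, List.mem_map_of_mem hj⟩))
  · rw [hs₂, Function.update_of_ne (hia i), k1 i hi]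
  · rw [hs₂, Function.update_of_ne (hia i), k2 i hi]
  · rw [hs₂, Function.update_self, k3 a hra]
    congr 1
    ext x
    simp only [Set.mem_iUnion, List.mem_map, exists_prop]
    constructor
    · rintro ⟨_, ⟨i, hi, rfl⟩, hx⟩
      rw [k3 _ (by omega)] at hx
      exact ⟨i, hi, hx⟩
    · rintro ⟨i, hi, hx⟩
      exact ⟨_, ⟨i, hi, rfl⟩, by rwa [k3 _ (by omega)]⟩
  · rw [hs₂, Function.update_of_ne hxa, k3 x hx]

/-- The registers `tmp + 1, …, tmp + N`, which hold the pieces. -/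
def pieceRegs (tmp N : ℕ) : List ℕ := (List.range N).map fun k => tmp + 1 + k

theorem mem_pieceRegs {tmp N x : ℕ} : x ∈ pieceRegs tmp N ↔ ∃ k : Fin N, tmp + 1 + k = x := by
  simp only [pieceRegs, List.mem_map, List.mem_range]
  exact ⟨fun ⟨k, hk, e⟩ => ⟨⟨k, hk⟩, e⟩, fun ⟨k, e⟩ => ⟨k, k.2, e⟩⟩

theorem nodup_pieceRegs (tmp N : ℕ) : (pieceRegs tmp N).Nodup :=
  List.nodup_range.map fun a b h => by simpa using h

/-- Divides a part of the residue in register `a` among the participants in `c :: l`; participant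
`c` is the cutter, and `tmp` together with the `N` registers after it is used as scratch memory. -/
noncomputable def divide (g : Bool) (a tmp N : ℕ) (c : Fin r) (l : List (Fin r)) : Program r :=
  block [.union tmp a a, cutOff c a tmp N (pieceRegs tmp N), turns g tmp l (pieceRegs tmp N),
    distribute g a (tmp + 1) N c l]

/-- A step divides disjoint parts `B i` of the residue without envy within the group, and reduces
what the residue means to the cutter by the factor `1 - 1 / N`. -/
theorem exec_divide {g : Bool} {a tmp N : ℕ} {c : Fin r} {l : List (Fin r)} (hra : r ≤ a)
    (hat : a < tmp) (hl : (c :: l).Nodup) (hN : 3 ^ l.length ≤ N) {s : State M}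
    (hA : MeasurableSet (s a)) (hsign : ∀ i ∈ c :: l, HasSign g (ψ i) (s a))
    {s' : State M} (hs' : s' = (divide g a tmp N c l).exec O s) :
    ∃ B : Fin r → Set M, (∀ i, MeasurableSet (B i)) ∧ (∀ i, B i ⊆ s a) ∧
      (∀ i j, i ≠ j → Disjoint (B i) (B j)) ∧ (∀ i, i ∉ c :: l → B i = ∅) ∧
      (∀ i ∈ c :: l, ∀ j ∈ c :: l, ψ i (B j) ≤ ψ i (B i)) ∧ (∀ i : Fin r, s' i = s i ∪ B i) ∧
      s' a = s a \ ⋃ i, B i ∧ (∀ x, r ≤ x → x < tmp → x ≠ a → s' x = s x) ∧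
      |ψ c (s' a)| ≤ (1 - 1 / N) * |ψ c (s a)| := by
  have hN0 : 0 < N := (pow_pos (by norm_num) _).trans_le hN
  have hN0' : (0 : ℝ) < N := by exact_mod_cast hN0
  have hreg : ∀ {x}, x ≤ tmp → x ∉ pieceRegs tmp N := fun hx h => by
    obtain ⟨k, hk⟩ := mem_pieceRegs.1 h
    omega
  set s₀ := Function.update s tmp (s a ∪ s a) with hs₀
  have e0 : s₀ tmp = s a := by simp [hs₀]
  have e0' : ∀ x, x ≠ tmp → s₀ x = s x := fun x hx => by simp [hs₀, hx]
  have e0a := e0' a hat.ne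
  have hlenP : (pieceRegs tmp N).length = N := by simp [pieceRegs]
  obtain ⟨h1, h2, h3⟩ := exec_cutOff O (g := g) (c := c) hN0 hat.ne (nodup_pieceRegs tmp N)
    (hreg hat.le) (hreg le_rfl) (s := s₀) (by rwa [e0]) (by rw [e0]; exact hsign c (by simp))
    (by rw [e0, e0a, hlenP]; field_simp) rfl
  set s₁ := (cutOff c a tmp N (pieceRegs tmp N)).exec O s₀ with hs₁
  rw [e0] at h1
  rw [e0a] at h3
  obtain ⟨t1, t2, Z, E, f, tZ, tE, tE', tfix, tle, tf, tinj, tmax⟩ := exec_turns O (g := g)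
    (G := {i | i ∈ c :: l}) hA (fun j hj => hsign j hj) (tmp := tmp) (S := {x | x ∈ pieceRegs tmp N})
    (hreg le_rfl) l (pieceRegs tmp N) s₁ hl.of_cons (fun i hi => List.mem_cons_of_mem _ hi)
    (nodup_pieceRegs tmp N) (fun x hx => hx) (by rwa [hlenP]) h1 rfl
  set s₂ := (turns g tmp l (pieceRegs tmp N)).exec O s₁ with hs₂
  have hkeep : ∀ x, x < tmp → s₂ x = s x := fun x hx => by
    rw [t2 x (hreg hx.le) hx.ne, h2 x (hreg hx.le) hx.ne, e0' x hx.ne]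
  have hs'₂ : s' = (distribute g a (tmp + 1) N c l).exec O s₂ := by rw [hs']; rfl
  -- The cutter gets a piece that has not been touched.
  obtain ⟨q, hqP, hqZ⟩ : ∃ q ∈ pieceRegs tmp N, q ∉ Z := by
    by_contra! hcon
    have := Finset.card_le_card
      (fun x hx => hcon x (List.mem_toFinset.1 hx) : (pieceRegs tmp N).toFinset ⊆ Z)
    rw [List.toFinset_card_of_nodup (nodup_pieceRegs tmp N), hlenP] at this
    omega
  have hqE : q ∈ E := tE' (by simp [hqP, hqZ])
  have hqv : ψ c (s₂ q) = ψ c (s a) / N := by rw [tfix q hqP hqZ, h3 q hqP]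
  have hc : c ∉ l := (List.nodup_cons.1 hl).1
  have hne : ∀ i ∈ l, i ≠ c := fun i hi e => hc (e ▸ hi)
  have hf' : ∀ i ∈ c :: l, ∃ k : Fin N, tmp + 1 + k = Function.update f c q i := by
    intro i hi
    rcases List.mem_cons.1 hi with rfl | hi
    · simpa using mem_pieceRegs.1 hqP
    · rw [Function.update_of_ne (hne i hi)]
      exact mem_pieceRegs.1 (List.mem_toFinset.1 (tE (tf i hi).2))
  have : Nonempty (Fin N) := ⟨⟨0, hN0⟩⟩
  choose! k hk using hf'
  obtain ⟨F, hF1, hF2, hF3, hF4, hF5, hF6, hF7⟩ := exec_distribute O (g := g) hra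
    (Nat.lt_succ_of_lt hat) hl s₂ (by
      refine ⟨k, fun i hi j hj hij => ?_, fun i hi j hj => ?_, ?_⟩
      · have hij' : Function.update f c q i = Function.update f c q j := by
          rw [← hk i hi, ← hk j hj, hij]
        rcases List.mem_cons.1 hi with rfl | hm <;> rcases List.mem_cons.1 hj with rfl | hm'
        · rfl
        · rw [Function.update_self, Function.update_of_ne (hne j hm')] at hij'
          exact absurd (hij' ▸ (tf j hm').1) hqZ
        · rw [Function.update_self, Function.update_of_ne (hne i hm)] at hij'
          exact absurd (hij' ▸ (tf i hm).1) hqZ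
        · rw [Function.update_of_ne (hne i hm), Function.update_of_ne (hne j hm')] at hij'
          exact tinj i hm j hm' hij'
      · rw [hk i hi, hk j hj]
        have hjE : Function.update f c q j ∈ E := by
          rcases List.mem_cons.1 hj with rfl | hm
          · simpa using hqE
          · rw [Function.update_of_ne (hne j hm)]; exact (tf j hm).2
        rcases List.mem_cons.1 hi with rfl | hm
        · rw [Function.update_self, hqv, ← h3 _ (List.mem_toFinset.1 (tE hjE))]
          exact tle _ hjE i hi
        · rw [Function.update_of_ne (hne i hm)]
          exact tmax i hm _ hjE
      · rw [value_progressForm, hk c (by simp), Function.update_self, hqv, hkeep a hat]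
        cases g <;> simp) hs'₂
  have hPF : ∀ i, tmp + 1 + (F i : ℕ) ∈ pieceRegs tmp N := fun i => mem_pieceRegs.2 ⟨F i, rfl⟩
  rw [hkeep a hat] at hF6
  classical
  refine ⟨fun i => if i ∈ c :: l then s₂ (tmp + 1 + F i) else ∅, fun i => ?_, fun i => ?_,
    fun i j hij => ?_, fun i hi => if_neg hi, fun i hi j hj => ?_, fun i => ?_, ?_,
    fun x hx hxt hxa => ?_, ?_⟩
  · dsimp only
    split_ifs
    · exact t1.meas _ (hPF i)
    · exact MeasurableSet.empty
  · dsimp only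
    split_ifs
    · exact t1.subset _ (hPF i)
    · exact Set.empty_subset _
  · dsimp only
    split_ifs with hi hj
    · exact t1.disj (hPF i) (hPF j) fun e => hij (hF1 i hi j hj (Fin.ext (by omega)))
    all_goals simp
  · simp only [if_pos hi, if_pos hj]
    exact hF2 i hi j hj
  · have hi : (i : ℕ) < tmp := i.2.trans_le (hra.trans hat.le)
    dsimp only
    split_ifs with h
    · rw [hF4 i h, hkeep i hi]
    · rw [hF5 i h, hkeep i hi, Set.union_empty]
  · rw [hF6]
    congr 1
    ext x
    simp only [Set.mem_iUnion, exists_prop]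
    refine exists_congr fun i => ?_
    split_ifs with h <;> simp [h]
  · rw [hF7 x hx hxa, hkeep x hxt]
  · have hC := t1.subset _ (hPF c)
    have hCm := t1.meas _ (hPF c)
    have hm : MeasurableSet (s' a) := by
      rw [hF6]
      exact hA.diff (Finset.measurableSet_biUnion (c :: l).toFinset
        (fun i _ => t1.meas _ (hPF i)) |> fun h => by simpa using h)
    have hsub : s' a ⊆ s a \ s₂ (tmp + 1 + F c) := by
      rw [hF6]
      refine Set.sdiff_subset_sdiff_right fun x hx => ?_
      simp only [Set.mem_iUnion]
      exact ⟨c, by simp, hx⟩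
    have hsc := hsign c (by simp)
    refine ((hsc.mono hA Set.sdiff_subset).abs_le_abs (hA.diff hCm) hm hsub).trans ?_
    have hd := (ψ c).of_add_of_sdiff hCm hA hC
    rw [value_progressForm, hkeep a hat] at hF3
    have hr : ∀ x : ℝ, (1 - 1 / (N : ℝ)) * x = x - x / N := fun x => by ring
    rw [hr]
    cases g
    · have q1 := hsc.nonpos hA (Set.sdiff_subset (s := s a) (t := s₂ (tmp + 1 + F c)))
      have q2 := hsc.nonpos hA subset_rfl
      rw [abs_of_nonpos q1, abs_of_nonpos q2, neg_div]
      simp at hF3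
      linarith
    · have q1 := hsc.nonneg hA (Set.sdiff_subset (s := s a) (t := s₂ (tmp + 1 + F c)))
      have q2 := hsc.nonneg hA subset_rfl
      rw [abs_of_nonneg q1, abs_of_nonneg q2]
      simp at hF3
      linarith

end Dividing

/-! ### The invariant of the algorithm -/

/-- The number of registers that survive the end of a stage: the shares of the participants and
the residues. -/
def keepReg (r : ℕ) : ℕ := r + Fintype.card (Finset (Fin r))

/-- The register of the residue with index `T`: the part, not yet distributed, of the set of points
that exactly the participants in `T` consider as goods. -/
noncomputable def resReg {r : ℕ} (T : Finset (Fin r)) : ℕ :=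
  r + Fintype.equivFin (Finset (Fin r)) T

theorem le_resReg {r : ℕ} (T : Finset (Fin r)) : r ≤ resReg T := Nat.le_add_right _ _

theorem resReg_lt {r : ℕ} (T : Finset (Fin r)) : resReg T < keepReg r :=
  Nat.add_lt_add_left (Fin.is_lt _) _

theorem resReg_ne_val {r : ℕ} (T : Finset (Fin r)) (i : Fin r) : resReg T ≠ i := fun e => by
  have := le_resReg T
  have := i.2
  omega

theorem resReg_injective {r : ℕ} : Function.Injective (resReg (r := r)) := fun T T' h => by
  have h' : (Fintype.equivFin (Finset (Fin r)) T : ℕ) = Fintype.equivFin (Finset (Fin r)) T' := by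
    simpa [resReg] using h
  exact (Fintype.equivFin _).injective (Fin.ext h')

theorem exists_reg_of_lt {r x : ℕ} (hx : x < keepReg r) :
    (∃ i : Fin r, x = i) ∨ ∃ T : Finset (Fin r), x = resReg T := by
  rcases lt_or_ge x r with h | h
  · exact Or.inl ⟨⟨x, h⟩, rfl⟩
  · refine Or.inr ⟨(Fintype.equivFin _).symm ⟨x - r, by unfold keepReg at hx; omega⟩, ?_⟩
    simp [resReg]
    omega

/-- The participants among whom the residue `T` is divided: those in `T`, who consider it as goods,
or everybody if it is a chore for everybody. -/
def group {r : ℕ} (T : Finset (Fin r)) : Finset (Fin r) := if T = ∅ then Finset.univ else T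

theorem group_nonempty {r : ℕ} (hr : 0 < r) (T : Finset (Fin r)) : (group T).Nonempty := by
  unfold group
  split_ifs with h
  · exact ⟨⟨0, hr⟩, Finset.mem_univ _⟩
  · exact Finset.nonempty_iff_ne_empty.2 h

variable {M : Type*} [MeasurableSpace M] {r : ℕ} {ψ : Fin r → SignedMeasure M}

/-- The shares and the residues partition the space, the residues have the signs that their indices
indicate, and nobody envies. -/
structure Inv (ψ : Fin r → SignedMeasure M) (s : State M) : Prop where
  meas_share : ∀ i : Fin r, MeasurableSet (s i)
  meas_res : ∀ T : Finset (Fin r), MeasurableSet (s (resReg T))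
  disj_share : ∀ i j : Fin r, i ≠ j → Disjoint (s i) (s j)
  disj_res : ∀ T T' : Finset (Fin r), T ≠ T' → Disjoint (s (resReg T)) (s (resReg T'))
  disj : ∀ (i : Fin r) (T : Finset (Fin r)), Disjoint (s i) (s (resReg T))
  cover : ∀ p, (∃ i : Fin r, p ∈ s i) ∨ ∃ T : Finset (Fin r), p ∈ s (resReg T)
  pos : ∀ T : Finset (Fin r), ∀ i ∈ T, 0 ≤[s (resReg T)] ψ i
  neg : ∀ T : Finset (Fin r), ∀ i ∉ T, ψ i ≤[s (resReg T)] 0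
  envyFree : ∀ i j : Fin r, ψ i (s j) ≤ ψ i (s i)

theorem Inv.congr {s s' : State M} (h : Inv ψ s) (hs : ∀ x < keepReg r, s' x = s x) :
    Inv ψ s' := by
  have h1 : ∀ i : Fin r, s' i = s i := fun i => hs i (i.2.trans_le (Nat.le_add_right _ _))
  have h2 : ∀ T : Finset (Fin r), s' (resReg T) = s (resReg T) := fun T => hs _ (resReg_lt T)
  constructor
  · simpa only [h1] using h.meas_share
  · simpa only [h2] using h.meas_res
  · simpa only [h1] using h.disj_share
  · simpa only [h2] using h.disj_res
  · simpa only [h1, h2] using h.disj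
  · simpa only [h1, h2] using h.cover
  · simpa only [h2] using h.pos
  · simpa only [h2] using h.neg
  · simpa only [h1] using h.envyFree

theorem Inv.hasSign {s : State M} (h : Inv ψ s) {T : Finset (Fin r)} {i : Fin r}
    (hi : i ∈ group T) : HasSign (decide (T ≠ ∅)) (ψ i) (s (resReg T)) := by
  unfold group at hi
  split_ifs at hi with hT
  · subst hT
    simpa [HasSign] using h.neg ∅ i (by simp)
  · simpa [HasSign, hT] using h.pos T i hi

theorem Inv.nonpos {s : State M} (h : Inv ψ s) {T : Finset (Fin r)} {i : Fin r}
    (hi : i ∉ group T) {B : Set M} (hB : B ⊆ s (resReg T)) : ψ i B ≤ 0 := by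
  refine (ψ i).nonpos_of_restrict_le_zero ((ψ i).restrict_le_zero_subset (h.meas_res T) hB
    (h.neg T i fun hiT => hi ?_))
  unfold group
  split_ifs
  · exact Finset.mem_univ i
  · exact hiT

/-- Distributing disjoint subsets of a residue without creating envy preserves the invariant. -/
theorem Inv.transfer {s s' : State M} (h : Inv ψ s) {T : Finset (Fin r)} {B : Fin r → Set M}
    (hm : ∀ i, MeasurableSet (B i)) (hB : ∀ i, B i ⊆ s (resReg T))
    (hd : ∀ i j, i ≠ j → Disjoint (B i) (B j)) (he : ∀ i j, ψ i (B j) ≤ ψ i (B i))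
    (h1 : ∀ i : Fin r, s' i = s i ∪ B i) (h2 : s' (resReg T) = s (resReg T) \ ⋃ i, B i)
    (h3 : ∀ T', T' ≠ T → s' (resReg T') = s (resReg T')) : Inv ψ s' := by
  have hsub : ∀ T', s' (resReg T') ⊆ s (resReg T') := fun T' => by
    by_cases hT : T' = T
    · subst hT; rw [h2]; exact Set.sdiff_subset
    · rw [h3 T' hT]
  have hsB : ∀ i j : Fin r, Disjoint (s i) (B j) := fun i j => (h.disj i T).mono_right (hB j)
  refine ⟨fun i => ?_, fun T' => ?_, fun i j hij => ?_, fun T₁ T₂ hT => ?_, fun i T' => ?_,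
    fun p => ?_, fun T' i hi => ?_, fun T' i hi => ?_, fun i j => ?_⟩
  · rw [h1]; exact (h.meas_share i).union (hm i)
  · by_cases hT : T' = T
    · subst hT; rw [h2]; exact (h.meas_res T').diff (MeasurableSet.iUnion hm)
    · rw [h3 T' hT]; exact h.meas_res T'
  · rw [h1, h1]
    exact Set.disjoint_union_left.2
      ⟨Set.disjoint_union_right.2 ⟨h.disj_share i j hij, hsB i j⟩,
        Set.disjoint_union_right.2 ⟨(hsB j i).symm, hd i j hij⟩⟩
  · exact (h.disj_res T₁ T₂ hT).mono (hsub T₁) (hsub T₂)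
  · rw [h1]
    refine Set.disjoint_union_left.2 ⟨(h.disj i T').mono_right (hsub T'), ?_⟩
    by_cases hT : T' = T
    · subst hT
      rw [h2]
      exact Set.disjoint_sdiff_right.mono_left (Set.subset_iUnion B i)
    · exact (h.disj_res T T' (Ne.symm hT)).mono (hB i) (hsub T')
  · by_cases hp : ∃ i, p ∈ B i
    · obtain ⟨i, hi⟩ := hp
      exact Or.inl ⟨i, by rw [h1]; exact Or.inr hi⟩
    · rcases h.cover p with ⟨i, hi⟩ | ⟨T', hT'⟩
      · exact Or.inl ⟨i, by rw [h1]; exact Or.inl hi⟩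
      · refine Or.inr ⟨T', ?_⟩
        by_cases hT : T' = T
        · subst hT; rw [h2]; exact ⟨hT', by simpa using hp⟩
        · rwa [h3 T' hT]
  · exact (ψ i).zero_le_restrict_subset (h.meas_res T') (hsub T') (h.pos T' i hi)
  · exact (ψ i).restrict_le_zero_subset (h.meas_res T') (hsub T') (h.neg T' i hi)
  · rw [h1, h1, (ψ i).of_union (hsB j j) (h.meas_share j) (hm j),
      (ψ i).of_union (hsB i i) (h.meas_share i) (hm i)]
    exact add_le_add (h.envyFree i j) (he i j)

/-- The shares have grown and the residues have shrunk. -/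
structure Progress {X : Type*} {r : ℕ} (s s' : State X) : Prop where
  share : ∀ i : Fin r, s i ⊆ s' i
  res : ∀ T : Finset (Fin r), s' (resReg T) ⊆ s (resReg T)

theorem Progress.trans {X : Type*} {s₁ s₂ s₃ : State X} (h : Progress (r := r) s₁ s₂)
    (h' : Progress (r := r) s₂ s₃) : Progress (r := r) s₁ s₃ :=
  ⟨fun i => (h.share i).trans (h'.share i), fun T => (h'.res T).trans (h.res T)⟩

/-! ### The rounds -/

variable (O : Oracle ψ)

/-- Divides a part of the residue `T` among its group, with `c` as the cutter. -/
noncomputable def divideRes (T : Finset (Fin r)) (c : Fin r) : Program r :=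
  divide (decide (T ≠ ∅)) (resReg T) (keepReg r) (3 ^ r) c ((group T).erase c).toList

theorem exec_divideRes {T : Finset (Fin r)} {c : Fin r} (hc : c ∈ group T) {s : State M}
    (h : Inv ψ s) {s' : State M} (hs' : s' = (divideRes T c).exec O s) :
    Inv ψ s' ∧ Progress (r := r) s s' ∧
      |ψ c (s' (resReg T))| ≤ (1 - 1 / 3 ^ r) * |ψ c (s (resReg T))| := by
  have hmem : ∀ i, i ∈ c :: ((group T).erase c).toList ↔ i ∈ group T := fun i => by
    by_cases hi : i = c
    · subst hi; simpa using hc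
    · simp [hi]
  have hlen : 3 ^ ((group T).erase c).toList.length ≤ 3 ^ r := by
    refine Nat.pow_le_pow_right (by norm_num) ?_
    rw [Finset.length_toList]
    exact (Finset.card_le_univ _).trans (by simp)
  obtain ⟨B, b1, b2, b3, b4, b5, b6, b7, b8, b9⟩ := exec_divide O (le_resReg T) (resReg_lt T)
    (List.nodup_cons.2 ⟨by simp, Finset.nodup_toList _⟩) hlen (h.meas_res T)
    (fun i hi => h.hasSign ((hmem i).1 hi)) hs'
  simp only [hmem] at b4 b5
  have hother : ∀ T', T' ≠ T → s' (resReg T') = s (resReg T') := fun T' hT =>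
    b8 _ (le_resReg T') (resReg_lt T') (resReg_injective.ne hT)
  refine ⟨h.transfer b1 b2 b3 (fun i j => ?_) b6 b7 hother, ⟨fun i => ?_, fun T' => ?_⟩, ?_⟩
  · by_cases hi : i ∈ group T
    · by_cases hj : j ∈ group T
      · exact b5 i hi j hj
      · -- Somebody is left out, so this is a residue of goods for the members of the group.
        have hT : T ≠ ∅ := by
          rintro rfl
          exact hj (by simp [group])
        have hs := h.hasSign hi
        rw [decide_eq_true hT] at hs
        rw [b4 j hj, VectorMeasure.empty]
        exact hs.nonneg (h.meas_res T) (b2 i)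
    · rw [b4 i hi, VectorMeasure.empty]
      exact h.nonpos hi (b2 j)
  · rw [b6]; exact Set.subset_union_left
  · by_cases hT : T' = T
    · subst hT; rw [b7]; exact Set.sdiff_subset
    · rw [hother T' hT]
  · simpa using b9

/-- Divides every residue once with every member of its group as the cutter. -/
noncomputable def roundProgram (r : ℕ) : Program r :=
  block ((Finset.univ.filter fun x : Finset (Fin r) × Fin r => x.2 ∈ group x.1).toList.map
    fun x => divideRes x.1 x.2)

theorem exec_roundProgram {s : State M} (h : Inv ψ s) {s' : State M}
    (hs' : s' = (roundProgram r).exec O s) :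
    Inv ψ s' ∧ Progress (r := r) s s' ∧ ∀ (T : Finset (Fin r)), ∀ c ∈ group T,
      |ψ c (s' (resReg T))| ≤ (1 - 1 / 3 ^ r) * |ψ c (s (resReg T))| := by
  have key : ∀ (l : List (Finset (Fin r) × Fin r)), (∀ x ∈ l, x.2 ∈ group x.1) →
      ∀ s : State M, Inv ψ s → ∀ s', s' = (block (l.map fun x => divideRes x.1 x.2)).exec O s →
        Inv ψ s' ∧ Progress (r := r) s s' ∧ ∀ x ∈ l,
          |ψ x.2 (s' (resReg x.1))| ≤ (1 - 1 / 3 ^ r) * |ψ x.2 (s (resReg x.1))| := by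
    intro l
    induction l with
    | nil =>
      rintro - s h s' rfl
      exact ⟨h, ⟨fun _ => subset_rfl, fun _ => subset_rfl⟩, by simp⟩
    | cons x l ih =>
      intro hl s h s' hs'
      have hx := hl x (by simp)
      obtain ⟨h1, h2, h3⟩ := exec_divideRes O hx h rfl
      obtain ⟨k1, k2, k3⟩ := ih (fun y hy => hl y (by simp [hy])) _ h1 s' hs'
      refine ⟨k1, h2.trans k2, fun y hy => ?_⟩
      rcases List.mem_cons.1 hy with rfl | hy
      · exact ((h1.hasSign hx).abs_le_abs (h1.meas_res _) (k1.meas_res _) (k2.res _)).trans h3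
      · have hy' := hl y (by simp [hy])
        refine (k3 y hy).trans (mul_le_mul_of_nonneg_left
          ((h.hasSign hy').abs_le_abs (h.meas_res _) (h1.meas_res _) (h2.res _)) ?_)
        rw [sub_nonneg, div_le_one (by positivity)]
        exact one_le_pow₀ (by norm_num)
  obtain ⟨k1, k2, k3⟩ := key _ (fun x hx => by simpa using hx) s h s' hs'
  exact ⟨k1, k2, fun T c hc => k3 (T, c) (by simpa using hc)⟩

/-! ### The initial program -/

/-- Stores in scratch registers the Hahn decompositions of the whole space for the given
participants. -/
def hahnAll (k : ℕ) (l : List (Fin r)) : Program r :=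
  block (l.map fun i : Fin r => block [.hahn i (k + 2 * i) 0, .diff (k + 2 * i + 1) 0 (k + 2 * i)])

theorem exec_hahnAll {k : ℕ} (hk : 0 < k) (l : List (Fin r)) (s : State M) :
    (∀ i ∈ l, (hahnAll k l).exec O s (k + 2 * (i : ℕ)) = O.hahn i (s 0) ∧
      (hahnAll k l).exec O s (k + 2 * (i : ℕ) + 1) = s 0 \ O.hahn i (s 0)) ∧
    (∀ i ∉ l, (hahnAll k l).exec O s (k + 2 * (i : ℕ)) = s (k + 2 * (i : ℕ)) ∧
      (hahnAll k l).exec O s (k + 2 * (i : ℕ) + 1) = s (k + 2 * (i : ℕ) + 1)) ∧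
    ∀ x < k, (hahnAll k l).exec O s x = s x := by
  induction l generalizing s with
  | nil => exact ⟨by simp, fun _ _ => ⟨rfl, rfl⟩, fun _ _ => rfl⟩
  | cons i l ih =>
    set s₁ := (block [.hahn i (k + 2 * i) 0, .diff (k + 2 * i + 1) 0 (k + 2 * i)]).exec O s with hs₁
    have he : (hahnAll k (i :: l)).exec O s = (hahnAll k l).exec O s₁ := rfl
    have e1 : ∀ x, s₁ x = if x = k + 2 * i + 1 then s 0 \ O.hahn i (s 0) else
        if x = k + 2 * i then O.hahn i (s 0) else s x := fun x => by
      have : (0 : ℕ) ≠ k + 2 * i := by omega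
      simp [hs₁, Program.exec, Function.update_apply, this]
    have e0 : s₁ 0 = s 0 := by rw [e1, if_neg (by omega), if_neg (by omega)]
    obtain ⟨h1, h2, h3⟩ := ih s₁
    rw [he]
    rw [e0] at h1
    refine ⟨fun j hj => ?_, fun j hj => ?_, fun x hx => ?_⟩
    · by_cases hjl : j ∈ l
      · exact h1 j hjl
      · have hji : j = i := by simpa [hjl] using hj
        subst hji
        rw [(h2 j hjl).1, (h2 j hjl).2]
        simp [e1]
    · simp only [List.mem_cons, not_or] at hj
      have hji : (j : ℕ) ≠ i := Fin.val_ne_of_ne hj.1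
      rw [(h2 j hj.2).1, (h2 j hj.2).2, e1, e1, if_neg (by omega), if_neg (by omega),
        if_neg (by omega), if_neg (by omega)]
      exact ⟨rfl, rfl⟩
    · rw [h3 x hx, e1, if_neg (by omega), if_neg (by omega)]

/-- Forms the residues with the given indices. -/
noncomputable def atoms (k : ℕ) (l : List (Finset (Fin r))) : Program r :=
  block (l.map fun T => .seq (.union (resReg T) 0 0) (diffs (resReg T)
    ((List.finRange r).map fun i => if i ∈ T then k + 2 * i + 1 else k + 2 * i)))

theorem exec_atoms {k : ℕ} (hr : 0 < r) (hk : keepReg r ≤ k) (H : Fin r → Set M)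
    (l : List (Finset (Fin r))) {s : State M} (h0 : s 0 = Set.univ)
    (hH : ∀ i : Fin r, s (k + 2 * i) = H i ∧ s (k + 2 * i + 1) = Set.univ \ H i) :
    (∀ T ∈ l, (atoms k l).exec O s (resReg T) = {p | ∀ i, p ∈ H i ↔ i ∈ T}) ∧
      ∀ x, (∀ T ∈ l, x ≠ resReg T) → (atoms k l).exec O s x = s x := by
  induction l generalizing s with
  | nil => exact ⟨by simp, fun _ _ => rfl⟩
  | cons T l ih =>
    set xs := (List.finRange r).map fun i : Fin r => if i ∈ T then k + 2 * (i : ℕ) + 1 else k + 2 * i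
      with hxs
    have hlt := resReg_lt T
    have hle := le_resReg T
    have he : (atoms k (T :: l)).exec O s = (atoms k l).exec O
        ((diffs (resReg T) xs).exec O (Function.update s (resReg T) (s 0 ∪ s 0))) := rfl
    have hxsge : ∀ x ∈ xs, x ≠ resReg T := fun x hx => by
      obtain ⟨i, -, rfl⟩ := List.mem_map.1 hx
      split_ifs <;> omega
    rw [he, exec_diffs O _ _ (fun h => hxsge _ h rfl), Function.update_self, Function.update_idem]
    set A := (s 0 ∪ s 0) \ ⋃ x ∈ xs, Function.update s (resReg T) (s 0 ∪ s 0) x with hA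
    have hA' : A = {p | ∀ i, p ∈ H i ↔ i ∈ T} := by
      ext p
      have hval : ∀ i : Fin r, Function.update s (resReg T) (s 0 ∪ s 0)
          (if i ∈ T then k + 2 * (i : ℕ) + 1 else k + 2 * i) =
            if i ∈ T then Set.univ \ H i else H i := fun i => by
        rw [Function.update_of_ne (hxsge _ (List.mem_map_of_mem (List.mem_finRange i)))]
        split_ifs
        · exact (hH i).2
        · exact (hH i).1
      have : p ∈ A ↔ ∀ i : Fin r, p ∉ Function.update s (resReg T) (s 0 ∪ s 0)
          (if i ∈ T then k + 2 * (i : ℕ) + 1 else k + 2 * i) := by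
        simp [hA, h0, hxs]
      rw [this]
      refine forall_congr' fun i => ?_
      rw [hval]
      split_ifs with hi <;> simp [hi]
    obtain ⟨k1, k2⟩ := ih (s := Function.update s (resReg T) A)
      (by rw [Function.update_of_ne (by omega), h0])
      (fun i => by
        rw [Function.update_of_ne (by omega), Function.update_of_ne (by omega)]
        exact hH i)
    refine ⟨fun T' hT' => ?_, fun x hx => ?_⟩
    · by_cases hl : T' ∈ l
      · exact k1 T' hl
      · have hTT : T' = T := by simpa [hl] using hT'
        subst hTT
        rw [k2 _ fun T₁ hT₁ e => hl ((resReg_injective e : T' = T₁) ▸ hT₁), Function.update_self, hA']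
    · rw [k2 x fun T₁ hT₁ => hx T₁ (by simp [hT₁]), Function.update_of_ne (hx T (by simp))]

/-- Sorts the points of the space according to the participants who consider them as goods. -/
noncomputable def initProgram (r : ℕ) : Program r :=
  block [hahnAll (keepReg r) (List.finRange r), atoms (keepReg r) Finset.univ.toList, .diff 0 0 0]

theorem exec_initProgram (hr : 0 < r) : Inv ψ ((initProgram r).exec O Algorithm.start) := by
  have hk : 0 < keepReg r := hr.trans_le (Nat.le_add_right _ _)
  obtain ⟨h1, -, h3⟩ := exec_hahnAll O hk (List.finRange r) Algorithm.start
  set s₁ := (hahnAll (keepReg r) (List.finRange r)).exec O Algorithm.start with hs₁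
  have e0 : (Algorithm.start 0 : Set M) = Set.univ := rfl
  rw [e0] at h1
  set H : Fin r → Set M := fun i => O.hahn i Set.univ with hHdef
  have hH := fun i => O.hahn_spec i Set.univ MeasurableSet.univ
  obtain ⟨k1, k2⟩ := exec_atoms O hr le_rfl H Finset.univ.toList (s := s₁) (by rw [h3 0 hk, e0])
    (fun i => h1 i (List.mem_finRange i))
  set s₂ := (atoms (keepReg r) Finset.univ.toList).exec O s₁ with hs₂
  have hs : (initProgram r).exec O Algorithm.start = Function.update s₂ 0 (s₂ 0 \ s₂ 0) := rfl
  rw [hs]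
  have hshare : ∀ i : Fin r, Function.update s₂ 0 (s₂ 0 \ s₂ 0) i = ∅ := fun i => by
    by_cases hi : (i : ℕ) = 0
    · rw [hi, Function.update_self, sdiff_self]; rfl
    · rw [Function.update_of_ne hi, k2 _ fun T _ => (resReg_ne_val T i).symm,
        h3 _ (i.2.trans_le (Nat.le_add_right _ _))]
      exact if_neg hi
  have hres : ∀ T : Finset (Fin r), Function.update s₂ 0 (s₂ 0 \ s₂ 0) (resReg T) =
      {p | ∀ i, p ∈ H i ↔ i ∈ T} := fun T => by
    rw [Function.update_of_ne (hr.trans_le (le_resReg T)).ne', k1 T (by simp)]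
  generalize Function.update s₂ 0 (s₂ 0 \ s₂ 0) = s₃ at hshare hres ⊢
  constructor
  · simp [hshare]
  · intro T
    rw [hres]
    have : {p | ∀ i, p ∈ H i ↔ i ∈ T} = ⋂ i, {p | p ∈ H i ↔ i ∈ T} := by ext; simp
    rw [this]
    refine MeasurableSet.iInter fun i => ?_
    by_cases hi : i ∈ T
    · simpa [hi] using (hH i).1
    · have : {p | p ∈ H i ↔ i ∈ T} = (H i)ᶜ := by ext; simp [hi]
      rw [this]
      exact (hH i).1.compl
  · simp [hshare]
  · intro T T' hT
    rw [hres, hres]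
    exact Set.disjoint_left.2 fun p hp hp' => hT (Finset.ext fun i => (hp i).symm.trans (hp' i))
  · simp [hshare]
  · classical
    exact fun p => Or.inr ⟨Finset.univ.filter fun i => p ∈ H i, by rw [hres]; simp⟩
  · intro T i hi
    rw [hres]
    exact (ψ i).zero_le_restrict_subset (hH i).1 (fun p hp => (hp i).2 hi) (hH i).2.2.1
  · intro T i hi
    rw [hres]
    exact (ψ i).restrict_le_zero_subset (MeasurableSet.univ.diff (hH i).1)
      (fun p hp => ⟨trivial, fun h => hi ((hp i).1 h)⟩) (hH i).2.2.2
  · simp [hshare]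

/-! ### The final program -/

/-- Gives the residues with the indices in the list to the participants chosen by `rep`. -/
noncomputable def giveAway (rep : Finset (Fin r) → Fin r) (l : List (Finset (Fin r))) : Program r :=
  block (l.map fun T => .seq (.union (rep T) (rep T) (resReg T))
    (.diff (resReg T) (resReg T) (resReg T)))

theorem exec_giveAway {rep : Finset (Fin r) → Fin r} (hrep : ∀ T, rep T ∈ group T)
    (l : List (Finset (Fin r))) {s : State M} (h : Inv ψ s)
    (h0 : ∀ T, ∀ i ∈ group T, ψ i (s (resReg T)) = 0) {s' : State M}
    (hs' : s' = (giveAway rep l).exec O s) :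
    Inv ψ s' ∧ ∀ T, (T ∈ l ∨ s (resReg T) = ∅) → s' (resReg T) = ∅ := by
  induction l generalizing s with
  | nil => subst hs'; exact ⟨h, fun T hT => by simpa using hT⟩
  | cons T l ih =>
    set s₁ := (Program.seq (.union (rep T) (rep T) (resReg T))
      (.diff (resReg T) (resReg T) (resReg T))).exec O s with hs₁
    have e1 : s₁ (resReg T) = ∅ := by simp [hs₁, Program.exec]
    have e2 : ∀ T', T' ≠ T → s₁ (resReg T') = s (resReg T') := fun T' hT => by
      simp [hs₁, Program.exec, Function.update_of_ne (resReg_injective.ne hT),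
        Function.update_of_ne (resReg_ne_val T' (rep T))]
    have e3 : ∀ i : Fin r, s₁ i = s i ∪ if i = rep T then s (resReg T) else ∅ := fun i => by
      have hne := (resReg_ne_val T i).symm
      by_cases hi : i = rep T
      · subst hi
        simp [hs₁, Program.exec, Function.update_of_ne hne]
      · simp [hs₁, Program.exec, Function.update_of_ne hne, hi,
          Function.update_of_ne (Fin.val_ne_of_ne hi)]
    have h1 : Inv ψ s₁ := by
      refine h.transfer (B := fun i => if i = rep T then s (resReg T) else ∅) (fun i => ?_)
        (fun i => ?_) (fun i j hij => ?_) (fun i j => ?_) e3 ?_ e2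
      · split_ifs
        · exact h.meas_res T
        · exact MeasurableSet.empty
      · split_ifs
        · exact subset_rfl
        · exact Set.empty_subset _
      · by_cases hi : i = rep T
        · simp [show j ≠ rep T from fun e => hij (hi.trans e.symm)]
        · simp [hi]
      · by_cases hi : i ∈ group T
        · have hz : ∀ j, ψ i (if j = rep T then s (resReg T) else ∅) = 0 := fun j => by
            split_ifs
            · exact h0 T i hi
            · exact (ψ i).empty
          rw [hz, hz]
        · rw [if_neg fun e : i = rep T => hi (e ▸ hrep T), (ψ i).empty]
          split_ifs
          · exact h.nonpos hi subset_rfl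
          · rw [(ψ i).empty]
      · rw [e1]
        refine (Set.sdiff_eq_empty.2 fun p hp => Set.mem_iUnion.2 ⟨rep T, ?_⟩).symm
        rwa [if_pos rfl]
    have h01 : ∀ T', ∀ i ∈ group T', ψ i (s₁ (resReg T')) = 0 := fun T' i hi => by
      by_cases hT : T' = T
      · subst hT; rw [e1, (ψ i).empty]
      · rw [e2 T' hT]; exact h0 T' i hi
    obtain ⟨k1, k2⟩ := ih h1 h01 hs'
    refine ⟨k1, fun T' hT' => k2 T' ?_⟩
    by_cases hT : T' = T
    · subst hT; exact Or.inr e1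
    · rw [e2 T' hT]; simpa [hT] using hT'

/-! ### The limit of the rounds -/

section Limit

open Filter Topology

theorem limits_eq_iUnion_of_monotone {X : Type*} {A : ℕ → Set X} (h : Monotone A) :
    upperLimit A = ⋃ n, A n ∧ lowerLimit A = ⋃ n, A n := by
  constructor <;> ext p <;> simp only [upperLimit, lowerLimit, Set.mem_iUnion, Set.mem_iInter]
  · exact ⟨fun hp => by obtain ⟨k, -, hk⟩ := hp 0; exact ⟨k, hk⟩,
      fun ⟨k, hk⟩ n => ⟨max n k, le_max_left _ _, h (le_max_right n k) hk⟩⟩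
  · exact ⟨fun ⟨n, hn⟩ => ⟨n, hn n le_rfl⟩, fun ⟨n, hn⟩ => ⟨n, fun k hk => h hk hn⟩⟩

theorem limits_eq_iInter_of_antitone {X : Type*} {A : ℕ → Set X} (h : Antitone A) :
    upperLimit A = ⋂ n, A n ∧ lowerLimit A = ⋂ n, A n := by
  constructor <;> ext p <;> simp only [upperLimit, lowerLimit, Set.mem_iUnion, Set.mem_iInter]
  · exact ⟨fun hp n => by obtain ⟨k, hk, hpk⟩ := hp n; exact h hk hpk,
      fun hp n => ⟨n, le_rfl, hp n⟩⟩
  · exact ⟨fun ⟨n, hn⟩ k => h (le_max_right n k) (hn _ (le_max_left n k)),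
      fun hp => ⟨0, fun k _ => hp k⟩⟩

/-- The invariant passes to the limit. -/
theorem Inv.limit {s : ℕ → State M} (h : ∀ n, Inv ψ (s n))
    (hp : ∀ n, Progress (r := r) (s n) (s (n + 1))) :
    Inv ψ fun k => lowerLimit fun n => s n k := by
  have hmono : ∀ i : Fin r, Monotone fun n => s n i := fun i =>
    monotone_nat_of_le_succ fun n => (hp n).share i
  have hanti : ∀ T : Finset (Fin r), Antitone fun n => s n (resReg T) := fun T =>
    antitone_nat_of_succ_le fun n => (hp n).res T
  have h1 : ∀ i : Fin r, lowerLimit (fun n => s n i) = ⋃ n, s n i := fun i =>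
    (limits_eq_iUnion_of_monotone (hmono i)).2
  have h2 : ∀ T : Finset (Fin r), lowerLimit (fun n => s n (resReg T)) = ⋂ n, s n (resReg T) :=
    fun T => (limits_eq_iInter_of_antitone (hanti T)).2
  constructor
  · intro i
    rw [h1]; exact MeasurableSet.iUnion fun n => (h n).meas_share i
  · intro T
    rw [h2]; exact MeasurableSet.iInter fun n => (h n).meas_res T
  · intro i j hij
    rw [h1, h1]
    refine Set.disjoint_left.2 fun p hi hj => ?_
    obtain ⟨n, hn⟩ := Set.mem_iUnion.1 hi
    obtain ⟨m, hm⟩ := Set.mem_iUnion.1 hj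
    exact Set.disjoint_left.1 ((h (max n m)).disj_share i j hij) (hmono i (le_max_left n m) hn)
      (hmono j (le_max_right n m) hm)
  · intro T T' hT
    rw [h2, h2]
    exact ((h 0).disj_res T T' hT).mono (Set.iInter_subset _ 0) (Set.iInter_subset _ 0)
  · intro i T
    rw [h1, h2]
    refine Set.disjoint_left.2 fun p hi hT => ?_
    obtain ⟨n, hn⟩ := Set.mem_iUnion.1 hi
    exact Set.disjoint_left.1 ((h n).disj i T) hn (Set.mem_iInter.1 hT n)
  · intro p
    simp only [h1, h2, Set.mem_iUnion, Set.mem_iInter]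
    by_contra! hcon
    obtain ⟨hs, hr⟩ := hcon
    -- Residues only shrink, so an undistributed point always lies in the same residue.
    have hres : ∀ n, ∃ T : Finset (Fin r), p ∈ s n (resReg T) := fun n => by
      rcases (h n).cover p with ⟨i, hi⟩ | hT
      · exact absurd hi (hs i n)
      · exact hT
    obtain ⟨T, hT⟩ := hres 0
    obtain ⟨n, hn⟩ := hr T
    obtain ⟨T', hT'⟩ := hres n
    have hT0 := hanti T' (Nat.zero_le n) hT'
    by_cases hTT : T = T'
    · exact hn (hTT ▸ hT')
    · exact Set.disjoint_left.1 ((h 0).disj_res T T' hTT) hT hT0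
  · intro T i hi
    rw [h2]
    exact (ψ i).zero_le_restrict_subset ((h 0).meas_res T) (Set.iInter_subset _ 0)
      ((h 0).pos T i hi)
  · intro T i hi
    rw [h2]
    exact (ψ i).restrict_le_zero_subset ((h 0).meas_res T) (Set.iInter_subset _ 0)
      ((h 0).neg T i hi)
  · intro i j
    rw [h1, h1]
    exact le_of_tendsto_of_tendsto'
      ((ψ i).tendsto_vectorMeasure_iUnion_atTop_nat (hmono j) fun n => (h n).meas_share j)
      ((ψ i).tendsto_vectorMeasure_iUnion_atTop_nat (hmono i) fun n => (h n).meas_share i)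
      fun n => (h n).envyFree i j

/-- In the limit, a residue is worthless for a participant for whom it shrinks geometrically. -/
theorem value_limit_eq_zero {φ : SignedMeasure M} {A : ℕ → Set M} (hA : Antitone A)
    (hm : ∀ n, MeasurableSet (A n)) {κ : ℝ} (h0 : 0 ≤ κ) (h1 : κ < 1)
    (h : ∀ n, |φ (A (n + 1))| ≤ κ * |φ (A n)|) : φ (lowerLimit A) = 0 := by
  rw [(limits_eq_iInter_of_antitone hA).2]
  have hb : ∀ n, |φ (A n)| ≤ κ ^ n * |φ (A 0)| := fun n => by
    induction n with
    | zero => simp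
    | succ n ih =>
      rw [pow_succ', mul_assoc]
      exact (h n).trans (mul_le_mul_of_nonneg_left ih h0)
  have hz : Tendsto (fun n => κ ^ n * |φ (A 0)|) atTop (𝓝 0) := by
    simpa using (tendsto_pow_atTop_nhds_zero_of_lt_one h0 h1).mul_const |φ (A 0)|
  exact tendsto_nhds_unique (φ.tendsto_vectorMeasure_iInter_atTop_nat hA hm)
    (squeeze_zero_norm hb hz)

end Limit

/-! ### The algorithm -/

/-- The algorithm: residues are first sorted by sign, then divided again and again, and what is left
in the limit is given to participants for whom it is worthless. -/
noncomputable def fairDivision (r : ℕ) (hr : 0 < r) : Algorithm r where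
  keep := keepReg r
  init := initProgram r
  round := roundProgram r
  final := giveAway (fun T => (group_nonempty hr T).choose) Finset.univ.toList

theorem fairDivision_spec (hr : 0 < r) :
    (fairDivision r hr).Converges O ∧ IsStrongSolution ψ ((fairDivision r hr).output O) := by
  set 𝒜 := fairDivision r hr with h𝒜
  have hclear : ∀ (s : State M), ∀ x < keepReg r, 𝒜.clear s x = s x := fun s x hx => if_pos hx
  have hinv : ∀ n, Inv ψ (𝒜.stage O n) := fun n => by
    induction n with
    | zero => exact (exec_initProgram O hr).congr (hclear _)
    | succ n ih => exact (exec_roundProgram O ih rfl).1.congr (hclear _)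
  have hres : ∀ n (T : Finset (Fin r)), 𝒜.stage O (n + 1) (resReg T) =
      (roundProgram r).exec O (𝒜.stage O n) (resReg T) := fun n T => hclear _ _ (resReg_lt T)
  have hshare : ∀ n (i : Fin r), 𝒜.stage O (n + 1) i =
      (roundProgram r).exec O (𝒜.stage O n) i := fun n i =>
    hclear _ _ (i.2.trans_le (Nat.le_add_right _ _))
  have hprog : ∀ n, Progress (r := r) (𝒜.stage O n) (𝒜.stage O (n + 1)) := fun n => by
    have := (exec_roundProgram O (hinv n) rfl).2.1
    exact ⟨fun i => by rw [hshare]; exact this.share i, fun T => by rw [hres]; exact this.res T⟩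
  have hanti : ∀ T : Finset (Fin r), Antitone fun n => 𝒜.stage O n (resReg T) := fun T =>
    antitone_nat_of_succ_le fun n => (hprog n).res T
  have hpow : (1 : ℝ) ≤ 3 ^ r := one_le_pow₀ (by norm_num)
  have hnull : ∀ T : Finset (Fin r), ∀ i ∈ group T,
      ψ i (lowerLimit fun n => 𝒜.stage O n (resReg T)) = 0 := fun T i hi => by
    refine value_limit_eq_zero (hanti T) (fun n => (hinv n).meas_res T) (κ := 1 - 1 / 3 ^ r) ?_ ?_
      fun n => ?_
    · rw [sub_nonneg, div_le_one (by positivity)]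
      exact hpow
    · rw [sub_lt_self_iff]
      positivity
    · rw [hres]
      exact (exec_roundProgram O (hinv n) rfl).2.2 T i hi
  constructor
  · intro k
    rcases lt_or_ge k (keepReg r) with hk | hk
    · rcases exists_reg_of_lt hk with ⟨i, rfl⟩ | ⟨T, rfl⟩
      · have := limits_eq_iUnion_of_monotone
          (monotone_nat_of_le_succ fun n => (hprog n).share i)
        exact this.1.trans this.2.symm
      · have := limits_eq_iInter_of_antitone (hanti T)
        exact this.1.trans this.2.symm
    · have hconst : (fun n => 𝒜.stage O n k) = fun _ => ∅ := by
        funext n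
        cases n <;> exact if_neg (not_lt.2 hk)
      have := limits_eq_iUnion_of_monotone (monotone_const (α := ℕ) (c := (∅ : Set M)))
      rw [SetConvergent, hconst]
      exact this.1.trans this.2.symm
  · obtain ⟨h1, h2⟩ := exec_giveAway O (fun T => (group_nonempty hr T).choose_spec)
      Finset.univ.toList (Inv.limit hinv hprog) hnull rfl
    refine ⟨⟨h1.meas_share, h1.disj_share, Set.eq_univ_of_forall fun p => ?_⟩, h1.envyFree⟩
    rcases h1.cover p with hp | ⟨T, hT⟩
    · exact Set.mem_iUnion.2 hp
    · rw [h2 T (Or.inl (by simp))] at hT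
      exact absurd hT (Set.notMem_empty p)

end FairDivision

theorem theorem1 (r : ℕ) (hr : 0 < r) :
    (∀ (M : Type*) [MeasurableSpace M] (ψ : Fin r → SignedMeasure M),
      (∀ i, FairDivision.NonAtomic (ψ i)) →
        ∃ F : Fin r → Set M, FairDivision.IsStrongSolution ψ F) ∧
    ∃ 𝒜 : FairDivision.Algorithm r,
      ∀ (M : Type*) [MeasurableSpace M] (ψ : Fin r → SignedMeasure M),
        (∀ i, FairDivision.NonAtomic (ψ i)) →
          Nonempty (FairDivision.Oracle ψ) ∧
          ∀ O : FairDivision.Oracle ψ,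
            𝒜.Converges O ∧ FairDivision.IsStrongSolution ψ (𝒜.output O) := by
  refine ⟨fun M _ ψ hψ => ?_, FairDivision.fairDivision r hr, fun M _ ψ hψ =>
    ⟨FairDivision.Oracle.nonempty hψ, fun O => FairDivision.fairDivision_spec O hr⟩⟩
  obtain ⟨O⟩ := FairDivision.Oracle.nonempty hψ
  exact ⟨_, (FairDivision.fairDivision_spec O hr).2⟩
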